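/- \textbf{Definitions.} A \emph{Family Tree} is a locally finite directed tree in which every vertex has out-degree at most one; if there is an arc from $u$ to $v$, then $v$ is the \emph{parent} of $u$ and $u$ a \emph{child} of $v$. Let $F(u)$ be the parent of $u$ if there is one, and $F(u)=u$ otherwise. The tree is \emph{eternal} (an EFT) if every vertex has a parent, and \emph{ordered} if the children of every vertex carry a total order $<$. Let $\mathcal T_*$ (resp. $\mathcal T_{**}$) be the space of isomorphism classes $[T,o]$ (resp. $[T,o,u]$) of ordered Family Trees with one (resp. two) distinguished vertices, with the Borel $\sigma$-algebra of the local topology. A random element $[\mathbf T,\mathbf o]$ of $\mathcal T_*$ is \emph{unimodular} if $$\mathbb E\Big[\sum_{u\in V(\mathbf T)}f([\mathbf T,\mathbf o,u])\Big]=\mathbb E\Big[\sum_{u\in V(\mathbf T)}f([\mathbf T,u,\mathbf o])\Big]$$ for every measurable $f:\mathcal T_{**}\to[0,\infty)$. For vertices $u,v$ of an ordered Family Tree, write $u\prec v$ if $u\neq v$ and $v=F^k(u)$ for some $k$, or if there are $m,n\ge 0$ such that $F^m(u)$ and $F^n(v)$ are distinct siblings with $F^m(u)<F^n(v)$. Let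 $b(u)=\max\{v:v\prec u\}$ and $a(u)=\min\{v:v\succ u\}$ (maximum and minimum with respect to $\prec$) whenever these exist, and $b(u)=u$, resp. $a(u)=u$, otherwise. The \emph{succession line} through $o$ is the sequence $(u_n)_{n\in\mathbb Z}$ with $u_0=o$, $u_n=a(u_{n-1})$ for $n>0$ and $u_n=b(u_{n+1})$ for $n<0$. The tree $T$ has a \emph{unique succession line} if the succession lines through all of its vertices are the same set of vertices. The \emph{backward map} $\Phi_R$ sends $[T,o]$ to the sequence $y=(y_n)_{n\in\mathbb Z}$, $y_n=d_1(u_{n+1})-1$, where $d_1(u)$ is the number of children of $u$ and $(u_n)$ is the succession line through $o$. An EFT is of \emph{class $\mathcal I/\mathcal I$} if all of its generations $\{w:F^n(w)=F^n(v)\text{ for some }n\ge0\}$, $v\in V(T)$, are infinite, every vertex has finitely many descendants, and there is no bi-infinite directed path. For an integer sequence $x=(x_n)_{n\in\mathbb Z}$ let $R_x(n)$ be the smallest $j>n$ with $\sum_{l=n}^{j-1}x_l\ge 0$ if there is one, and $R_x(n)=n$ otherwise. The \emph{record graph} $\mathbb Z^R_x$ has vertex set $\mathbb Z$ and an arc from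 $n$ to $R_x(n)$ for every $n$ with $R_x(n)\ne n$. Its component $\mathbb Z^R_x(0)$ of $0$ is a Family Tree, whose siblings are ordered as integers. \textbf{Theorem.} Let $[\mathbf T,\mathbf o]$ be a unimodular ordered Family Tree that is almost surely eternal. \begin{enumerate} \item Almost surely, if $\mathbf T$ is of class $\mathcal I/\mathcal I$, then $\mathbf T$ has a unique succession line. \item Suppose that $\mathbf T$ almost surely has a unique succession line (in particular, suppose that $\mathbf T$ is almost surely of class $\mathcal I/\mathcal I$). Then there is a stationary sequence $Y=(Y_n)_{n\in\mathbb Z}$ of random variables with values in $\{-1,0,1,2,\dots\}$ such that $[\mathbf T,\mathbf o]$ and $[\mathbb Z^R_Y(0),0]$ have the same distribution. Moreover, $Y$ can be taken on the probability space of $[\mathbf T,\mathbf o]$ with $Y=\Phi_R([\mathbf T,\mathbf o])$ almost surely. \end{enumerate} -/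

import Mathlib

open MeasureTheory ProbabilityTheory
open scoped NNReal ENNReal

/-- The undirected graph underlying the functional graph of `F : V → V`: there is an arc from `u` to
`F u` whenever `F u ≠ u` (self-loops are discarded). -/
def shiftGraph {V : Type} (F : V → V) : SimpleGraph V :=
  SimpleGraph.fromRel fun u v => F u = v

/-- An ordered Family Tree with vertex set `V`: a locally finite directed tree in which every vertex
has out-degree at most one, together with a total order on the children of every vertex.
The arcs are encoded by the parent vertex-shift `F`, which sends a vertex to its parent if it
has one and to itself otherwise; so the arcs are the pairs `(u, F u)` with `F u ≠ u`. -/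
structure OrderedFamilyTree (V : Type) where
  /-- The parent vertex-shift. -/
  F : V → V
  /-- `lt u v`: the vertices `u` and `v` are siblings and `u` is younger than `v`. -/
  lt : V → V → Prop
  isTree : (shiftGraph F).IsTree
  /-- There are no two opposite arcs between the same two vertices. -/
  no_two_cycle : ∀ u, F (F u) = u → F u = u
  finite_children : ∀ w, {v | F v = w ∧ v ≠ w}.Finite
  lt_sibling : ∀ u v, lt u v → F u = F v ∧ F u ≠ u ∧ F v ≠ v
  lt_irrefl : ∀ u, ¬ lt u u
  lt_trans : ∀ u v w, lt u v → lt v w → lt u w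
  lt_total : ∀ u v, F u = F v → F u ≠ u → F v ≠ v → u ≠ v → lt u v ∨ lt v u

namespace OrderedFamilyTree

variable {V : Type} (T : OrderedFamilyTree V)

/-- The arc from the vertex `u` to its parent `v`. -/
def Arc (u v : V) : Prop := T.F u = v ∧ u ≠ v

/-- The number `d₁(w)` of children of `w`. -/
noncomputable def numChildren (w : V) : ℕ := {v | T.Arc v w}.ncard

/-- Eternal Family Trees: every vertex has a parent. -/
def IsEternal : Prop := ∀ v, T.F v ≠ v

/-- The Royal Line of Succession order: `u ≺ v` if `v` is a proper ancestor of `u`, or if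
some ancestor `u'` of `u` (possibly `u`) and some ancestor `v'` of `v` (possibly `v`) are siblings
with `u'` younger than `v'`; the common parent of `u'` and `v'` is then the
smallest common ancestor of `u` and `v`. -/
def Prec (u v : V) : Prop :=
  (u ≠ v ∧ ∃ k : ℕ, T.F^[k] u = v) ∨ ∃ m n : ℕ, T.lt (T.F^[m] u) (T.F^[n] v)

/-- `v` is the maximum, for `≺`, of the vertices `w ≺ u`. -/
def IsSucc (u v : V) : Prop := T.Prec v u ∧ ∀ w, T.Prec w u → w = v ∨ T.Prec w v

/-- `v` is the minimum, for `≺`, of the vertices `w ≻ u`. -/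
def IsPred (u v : V) : Prop := T.Prec u v ∧ ∀ w, T.Prec u w → w = v ∨ T.Prec v w

open Classical in
/-- `b(u) = max {v | v ≺ u}` if it exists, and `u` otherwise. -/
noncomputable def b (u : V) : V := if h : ∃ v, T.IsSucc u v then h.choose else u

open Classical in
/-- `a(u) = min {v | v ≻ u}` if it exists, and `u` otherwise. -/
noncomputable def a (u : V) : V := if h : ∃ v, T.IsPred u v then h.choose else u

/-- The succession line `(uₙ)` through `o`: `u₀ = o`, `uₙ = a(uₙ₋₁)` for `n > 0` and
`uₙ = b(uₙ₊₁)` for `n < 0`. -/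
noncomputable def successionLine (o : V) : ℤ → V
  | Int.ofNat n => T.a^[n] o
  | Int.negSucc n => T.b^[n + 1] o

/-- The succession lines of all the vertices are one and the same set of vertices. -/
def HasUniqueSuccessionLine : Prop :=
  ∀ u v, Set.range (T.successionLine u) = Set.range (T.successionLine v)

/-- Class I/I: every generation (the set of the vertices `w` with `Fⁿ w = Fⁿ v` for some `n`, for a
vertex `v`) is infinite, every vertex has finitely many descendants, and
there is no bi-infinite path of arcs. -/
def IsClassII : Prop :=
  (∀ v, {w | ∃ n : ℕ, T.F^[n] w = T.F^[n] v}.Infinite) ∧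
  (∀ v, {w | ∃ n : ℕ, T.F^[n] w = v}.Finite) ∧
  ¬ ∃ p : ℤ → V, ∀ n, T.Arc (p n) (p (n + 1))

end OrderedFamilyTree

/-- Ordered Family Trees with `k` distinguished vertices. Trees are countable, so nothing is lost by
taking the vertex sets in `Type`. -/
structure RootedOFT (k : ℕ) : Type 1 where
  V : Type
  T : OrderedFamilyTree V
  root : Fin k → V

namespace RootedOFT

variable {k : ℕ}

/-- Isomorphisms of ordered Family Trees that preserve the roots. -/
def Iso (G H : RootedOFT k) : Prop :=
  ∃ e : G.V ≃ H.V, (∀ u, e (G.T.F u) = H.T.F (e u)) ∧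
    (∀ u v, G.T.lt u v ↔ H.T.lt (e u) (e v)) ∧ ∀ i, e (G.root i) = H.root i

theorem iso_equivalence : Equivalence (@Iso k) where
  refl G := ⟨Equiv.refl _, fun _ => rfl, fun _ _ => Iff.rfl, fun _ => rfl⟩
  symm := by
    rintro G H ⟨e, h1, h2, h3⟩
    refine ⟨e.symm, fun u => ?_, fun u v => ?_, fun i => ?_⟩
    · rw [Equiv.symm_apply_eq, h1, Equiv.apply_symm_apply]
    · rw [h2, Equiv.apply_symm_apply, Equiv.apply_symm_apply]
    · rw [Equiv.symm_apply_eq, h3]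
  trans := by
    rintro G H K ⟨e, h1, h2, h3⟩ ⟨f, g1, g2, g3⟩
    exact ⟨e.trans f, fun u => by simp [h1, g1], fun u v => by simp [h2, g2],
      fun i => by simp [h3, g3]⟩

instance isoSetoid (k : ℕ) : Setoid (RootedOFT k) := ⟨Iso, iso_equivalence⟩

/-- The vertices at graph distance at most `r` from one of the roots. -/
def ball (G : RootedOFT k) (r : ℕ) : Set G.V :=
  {w | ∃ i, (shiftGraph G.T.F).dist w (G.root i) ≤ r}

/-- The substructures of `G` and `H` induced by the balls of radius `r` are isomorphic (as rooted
directed graphs with the sibling order). -/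
def BallIso (r : ℕ) (G H : RootedOFT k) : Prop :=
  ∃ e : G.ball r ≃ H.ball r,
    (∀ u v : G.ball r, G.T.Arc u v ↔ H.T.Arc (e u) (e v)) ∧
    (∀ u v : G.ball r, G.T.lt u v ↔ H.T.lt (e u) (e v)) ∧
    ∀ (u : G.ball r) (i : Fin k), (u : G.V) = G.root i ↔ (e u : H.V) = H.root i

end RootedOFT

/-- The space of isomorphism classes of ordered Family Trees with `k` roots. For `k = 1` this is the
space `𝒯_*` of rooted ordered Family Trees, for `k = 2` its doubly rooted analogue. -/
def TreeSpace (k : ℕ) : Type 1 := Quotient (RootedOFT.isoSetoid k)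

namespace TreeSpace

variable {k : ℕ}

/-- The isomorphism class of a tree with `k` roots. -/
def mk (G : RootedOFT k) : TreeSpace k := Quotient.mk _ G

/-- A representative of an isomorphism class. It is only used in notions that do not depend on
the choice of the representative. -/
noncomputable def rep (q : TreeSpace k) : RootedOFT k := Quotient.out q

/-- The local topology, generated by the sets of the trees whose ball of radius `r` is isomorphic to
a given one. -/
instance : TopologicalSpace (TreeSpace k) :=
  TopologicalSpace.generateFrom
    {C | ∃ (r : ℕ) (G : RootedOFT k), C = mk '' {H | RootedOFT.BallIso r H G}}

instance : MeasurableSpace (TreeSpace k) := borel _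

instance : BorelSpace (TreeSpace k) := ⟨rfl⟩

/-- The root of the chosen representative. -/
noncomputable def origin (q : TreeSpace 1) : q.rep.V := q.rep.root 0

/-- The doubly rooted tree `[T, u, v]`, for vertices `u` and `v` of `q = [T, o]`. -/
noncomputable def doublyRooted (q : TreeSpace 1) (u v : q.rep.V) : TreeSpace 2 :=
  mk ⟨q.rep.V, q.rep.T, ![u, v]⟩

/-- The backward map `Φ_R`. It sends `[T, o]` to the sequence `yₙ = d₁(uₙ₊₁) - 1`, where `(uₙ)` is the
succession line of `T` through `o`. -/
noncomputable def backwardMap (q : TreeSpace 1) (n : ℤ) : ℤ :=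
  (q.rep.T.numChildren (q.rep.T.successionLine q.origin (n + 1)) : ℤ) - 1

end TreeSpace

/-- A random rooted ordered Family Tree is unimodular if it satisfies the mass transport principle. -/
def IsUnimodular {Ω : Type*} [MeasurableSpace Ω] (X : Ω → TreeSpace 1) (P : Measure Ω) : Prop :=
  ∀ f : TreeSpace 2 → ℝ≥0, Measurable f →
    ∫⁻ ω, ∑' u : (X ω).rep.V, (f ((X ω).doublyRooted (X ω).origin u) : ℝ≥0∞) ∂P =
    ∫⁻ ω, ∑' u : (X ω).rep.V, (f ((X ω).doublyRooted u (X ω).origin) : ℝ≥0∞) ∂P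

/-- A random sequence indexed by `ℤ` is stationary if all its shifts have the same law. -/
def IsStationarySeq {Ω : Type*} [MeasurableSpace Ω] (Y : Ω → ℤ → ℤ) (P : Measure Ω) : Prop :=
  ∀ k : ℤ, IdentDistrib (fun ω n => Y ω (n + k)) Y P P

namespace RecordGraph

open Classical in
/-- The record map of the sequence `x`: it sends `n` to the smallest `j > n` such that
`xₙ + ⋯ + xⱼ₋₁ ≥ 0` if there is one, and to `n` otherwise. -/
noncomputable def recordMap (x : ℤ → ℤ) (n : ℤ) : ℤ :=
  if ∃ j, n < j ∧ 0 ≤ ∑ l ∈ Finset.Ico n j, x l then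
    sInf {j | n < j ∧ 0 ≤ ∑ l ∈ Finset.Ico n j, x l}
  else n

/-- The vertex set of the connected component of `0` in the record graph of `(ℤ, x)`. -/
def component (x : ℤ → ℤ) : Set ℤ := {i | (shiftGraph (recordMap x)).Reachable 0 i}

theorem recordMap_spec (x : ℤ → ℤ) (n : ℤ) :
    recordMap x n = n ∨ (n < recordMap x n ∧ 0 ≤ ∑ l ∈ Finset.Ico n (recordMap x n), x l ∧
      ∀ j, n < j → j < recordMap x n → ∑ l ∈ Finset.Ico n j, x l < 0) := by
  unfold recordMap
  split_ifs with h
  · right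
    have hb : BddBelow {j | n < j ∧ 0 ≤ ∑ l ∈ Finset.Ico n j, x l} := ⟨n, fun j hj => hj.1.le⟩
    have hm := Int.csInf_mem (s := {j | n < j ∧ 0 ≤ ∑ l ∈ Finset.Ico n j, x l}) h hb
    refine ⟨hm.1, hm.2, fun j h1 h2 => ?_⟩
    by_contra h3
    exact absurd (csInf_le hb (show j ∈ {j | n < j ∧ 0 ≤ ∑ l ∈ Finset.Ico n j, x l} from
      ⟨h1, not_lt.mp h3⟩)) (not_le.mpr h2)
  · exact Or.inl rfl

theorem le_recordMap (x : ℤ → ℤ) (n : ℤ) : n ≤ recordMap x n := by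
  rcases recordMap_spec x n with h | h
  · exact h.ge
  · exact h.1.le

theorem finite_children (x : ℤ → ℤ) (w : ℤ) : {v | recordMap x v = w ∧ v ≠ w}.Finite := by
  have key : ∀ v ∈ {v | recordMap x v = w ∧ v ≠ w}, v < w ∧ 0 ≤ ∑ l ∈ Finset.Ico v w, x l ∧
      ∀ j, v < j → j < w → ∑ l ∈ Finset.Ico v j, x l < 0 := by
    rintro v ⟨rfl, hv⟩
    rcases recordMap_spec x v with h | h
    · exact absurd h.symm hv
    · exact h
  have split : ∀ p q s : ℤ, p ≤ q → q ≤ s → ∑ l ∈ Finset.Ico p s, x l =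
      ∑ l ∈ Finset.Ico p q, x l + ∑ l ∈ Finset.Ico q s, x l := by
    intro p q s h1 h2
    rw [← Finset.sum_union (Finset.Ico_disjoint_Ico_consecutive p q s),
      Finset.Ico_union_Ico_eq_Ico h1 h2]
  have one : ∑ l ∈ Finset.Ico (w - 1) w, x l = x (w - 1) := by
    have : Finset.Ico (w - 1) w = {w - 1} := by ext; simp; omega
    rw [this, Finset.sum_singleton]
  refine Set.Finite.of_finite_image (f := fun v => ∑ l ∈ Finset.Ico v w, x l)
    ((Set.finite_Icc 0 (x (w - 1))).subset ?_) ?_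
  · rintro _ ⟨v, hv, rfl⟩
    obtain ⟨h1, h2, h3⟩ := key v hv
    refine ⟨h2, ?_⟩
    rcases (show v ≤ w - 1 by omega).eq_or_lt with h | h
    · subst h; exact one.le
    · have := h3 (w - 1) h (by omega)
      have h4 := split v (w - 1) w (by omega) (by omega)
      simp only
      omega
  · have aux : ∀ u ∈ {v | recordMap x v = w ∧ v ≠ w}, ∀ v ∈ {v | recordMap x v = w ∧ v ≠ w},
        u < v → ∑ l ∈ Finset.Ico u w, x l ≠ ∑ l ∈ Finset.Ico v w, x l := by
      intro u hu v hv huv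
      have h1 := (key u hu).2.2 v huv (key v hv).1
      have h2 := split u v w huv.le (key v hv).1.le
      omega
    intro u hu v hv h
    rcases lt_trichotomy u v with h' | h' | h'
    · exact absurd h (aux u hu v hv h')
    · exact h'
    · exact absurd h.symm (aux v hv u hu h')

theorem recordMap_mem (x : ℤ → ℤ) {i : ℤ} (hi : i ∈ component x) :
    recordMap x i ∈ component x := by
  by_cases h : recordMap x i = i
  · rwa [h]
  · exact SimpleGraph.Reachable.trans hi
      (SimpleGraph.Adj.reachable ((SimpleGraph.fromRel_adj _ _ _).2 ⟨Ne.symm h, Or.inl rfl⟩))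

/-- The record map restricted to the component of `0`. -/
noncomputable def componentMap (x : ℤ → ℤ) (i : component x) : component x :=
  ⟨recordMap x i, recordMap_mem x i.2⟩

theorem zero_mem (x : ℤ → ℤ) : (0 : ℤ) ∈ component x := SimpleGraph.Reachable.refl _

theorem component_isTree (x : ℤ → ℤ) : (shiftGraph (componentMap x)).IsTree := by
  have hle : ∀ i : component x, (i : ℤ) ≤ componentMap x i := fun i => le_recordMap x i
  refine ⟨?_, ?_⟩
  · have h0 : ∀ i, (shiftGraph (recordMap x)).Reachable 0 i → ∃ hi : i ∈ component x,
        (shiftGraph (componentMap x)).Reachable ⟨0, zero_mem x⟩ ⟨i, hi⟩ := by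
      intro i hi
      rw [SimpleGraph.reachable_iff_reflTransGen] at hi
      induction hi with
      | refl => exact ⟨zero_mem x, SimpleGraph.Reachable.refl _⟩
      | tail _ hadj ih =>
        obtain ⟨hb, ih⟩ := ih
        refine ⟨SimpleGraph.Reachable.trans hb hadj.reachable,
          ih.trans (SimpleGraph.Adj.reachable ?_)⟩
        obtain ⟨h1, h2⟩ := (SimpleGraph.fromRel_adj _ _ _).1 hadj
        refine (SimpleGraph.fromRel_adj _ _ _).2 ⟨fun h => h1 (congrArg Subtype.val h), ?_⟩
        exact h2.imp (fun h => Subtype.ext h) (fun h => Subtype.ext h)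
    have : Nonempty (component x) := ⟨⟨0, zero_mem x⟩⟩
    refine ⟨fun u v => ?_⟩
    obtain ⟨_, hu⟩ := h0 u u.2
    obtain ⟨_, hv⟩ := h0 v v.2
    exact hu.symm.trans hv
  · intro v c hc
    classical
    obtain ⟨m, hm, hmin⟩ := c.support.toFinset.exists_min_image (fun u => (u : ℤ))
      ⟨v, by simp⟩
    have hm' : m ∈ c.support := by simpa using hm
    have hc' := hc.rotate hm'
    have hadj : ∀ u ∈ (c.rotate m hm').support, (shiftGraph (componentMap x)).Adj m u →
        u = componentMap x m := by
      intro u hu h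
      obtain ⟨h1, h2⟩ := (SimpleGraph.fromRel_adj _ _ _).1 h
      rcases h2 with h2 | h2
      · exact h2.symm
      · have hu' : u ∈ c.support := by
          rwa [SimpleGraph.Walk.mem_support_rotate_iff] at hu
        have h3 := hmin u (by simpa using hu')
        have h4 := hle u
        rw [h2] at h4
        exact absurd (Subtype.ext (le_antisymm h3 h4)) h1
    apply hc'.snd_ne_penultimate
    have h1 := hadj _ (SimpleGraph.Walk.getVert_mem_support _ _)
      (SimpleGraph.Walk.adj_snd hc'.not_nil)
    have h2 := hadj _ (SimpleGraph.Walk.getVert_mem_support _ _)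
      (SimpleGraph.Walk.adj_penultimate hc'.not_nil).symm
    exact h1.trans h2.symm

/-- The component of `0` in the record graph of `(ℤ, x)`, as an ordered Family Tree: the parent of an
integer is its record, and children are ordered as integers. -/
noncomputable def componentTree (x : ℤ → ℤ) : OrderedFamilyTree (component x) where
  F := componentMap x
  lt u v := componentMap x u = componentMap x v ∧ componentMap x u ≠ u ∧ componentMap x v ≠ v ∧
    (u : ℤ) < v
  isTree := component_isTree x
  no_two_cycle u h := by
    have h1 := le_recordMap x u
    have h2 := le_recordMap x (recordMap x u)
    have h3 : recordMap x (recordMap x u) = u := congrArg Subtype.val h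
    exact Subtype.ext (le_antisymm (h2.trans h3.le) h1)
  finite_children w := by
    refine Set.Finite.of_finite_image (f := Subtype.val)
      ((finite_children x w).subset ?_) Subtype.val_injective.injOn
    rintro _ ⟨v, ⟨h1, h2⟩, rfl⟩
    exact ⟨congrArg Subtype.val h1, fun h => h2 (Subtype.ext h)⟩
  lt_sibling u v h := ⟨h.1, h.2.1, h.2.2.1⟩
  lt_irrefl u h := lt_irrefl _ h.2.2.2
  lt_trans u v w h1 h2 :=
    ⟨h1.1.trans h2.1, h1.2.1, h2.2.2.1, h1.2.2.2.trans h2.2.2.2⟩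
  lt_total u v h1 h2 h3 h4 := by
    rcases lt_or_gt_of_ne (fun h => h4 (Subtype.ext h) : (u : ℤ) ≠ v) with h | h
    · exact Or.inl ⟨h1, h2, h3, h⟩
    · exact Or.inr ⟨h1.symm, h3, h2, h⟩

/-- The rooted tree `[ℤ^R_x(0), 0]`, the component of `0` in the record graph of `(ℤ, x)`. -/
noncomputable def rootedComponent (x : ℤ → ℤ) : TreeSpace 1 :=
  TreeSpace.mk ⟨component x, componentTree x, ![⟨0, zero_mem x⟩]⟩

end RecordGraph

/-! ### The succession order of an eternal tree is a strict total order -/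

namespace OrderedFamilyTree

variable {V : Type} {T : OrderedFamilyTree V}

/-! On an eternal tree `Prec` is a strict total order. All vertices between `u` and `v` descend from
any common ancestor, so finite descendant sets make every interval finite and every succession line
reach every vertex (`IsEternal.hasUniqueSuccessionLine`).

Suppose the succession line is unique. It cannot stop upwards, since `F u` always follows `u`. If it
stopped downwards, there would be a minimum, and for each `n` at most one vertex would have exactly
`n` predecessors. By mass transport on an infinite tree, the root is almost surely not such a vertex
(`IsUnimodular.measure_eq_zero`), so the order is almost surely that of ℤ
(`IsUnimodular.ae_isBiinfinite`).

Number the vertices by ℤ along the line. The parent map becomes a map `π` with `m < π m` whose arcs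
do not cross. Such a map is the record map of the sequence of its fibre sizes minus one
(`RecordGraph.recordMap_eq_of_noncrossing`), which yields the tree from its backward sequence
(`IsBiinfinite.mk_eq_rootedComponent`). The successor map is a bijection of the vertices, so mass
transport makes the law of the tree invariant under moving the root along it
(`IsUnimodular.lintegral_successor`). On sequences this move is the shift, whence stationarity.

Measurability rests on `IsLocal`: a property that some finite ball around the roots certifies
defines an open set. The successor relation is local because it has a description within a bounded
distance of its two vertices (`IsEternal.isPred_iff_localPred`). -/

theorem shiftGraph_adj_iff {V : Type} {F : V → V} {u v : V} :
    (shiftGraph F).Adj u v ↔ u ≠ v ∧ (F u = v ∨ F v = u) :=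
  SimpleGraph.fromRel_adj _ _ _

/-- Iterating the parent map of an eternal tree never returns to the starting vertex. -/
theorem IsEternal.iterate_ne (hE : T.IsEternal) (u : V) {k : ℕ} (hk : 0 < k) : T.F^[k] u ≠ u := by
  classical
  intro hku
  have hex : ∃ k, 0 < k ∧ T.F^[k] u = u := ⟨k, hk, hku⟩
  obtain ⟨hm, hmu⟩ := Nat.find_spec hex
  have hmin : ∀ i, 0 < i → i < Nat.find hex → T.F^[i] u ≠ u := fun i hi hlt h =>
    Nat.find_min hex hlt ⟨hi, h⟩
  generalize Nat.find hex = m at hm hmu hmin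
  have hadj : (shiftGraph T.F).Adj u (T.F u) :=
    shiftGraph_adj_iff.2 ⟨(hE u).symm, Or.inl rfl⟩
  have hb := SimpleGraph.isAcyclic_iff_forall_adj_isBridge.1 T.isTree.isAcyclic hadj
  rw [SimpleGraph.isBridge_iff] at hb
  refine hb ?_
  -- The rest of the cycle joins `F u` to `u` without the bridge: minimality of `m` forbids starting
  -- again from `u`, and `no_two_cycle` forbids the reverse arc.
  have key : ∀ i, 1 ≤ i → i ≤ m → ((shiftGraph T.F).deleteEdges {s(u, T.F u)}).Reachable
      (T.F u) (T.F^[i] u) := by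
    intro i hi
    induction i, hi using Nat.le_induction with
    | base => intro _; exact SimpleGraph.Reachable.refl _
    | succ i hi ih =>
      intro hi'
      refine (ih (by omega)).trans (SimpleGraph.Adj.reachable ?_)
      rw [Function.iterate_succ_apply', SimpleGraph.deleteEdges_adj]
      refine ⟨shiftGraph_adj_iff.2 ⟨(hE _).symm, Or.inl rfl⟩, ?_⟩
      rw [Set.mem_singleton_iff, Sym2.eq_iff]
      rintro (⟨h, -⟩ | ⟨h1, h2⟩)
      · exact hmin i (by omega) (by omega) h
      · rw [h1] at h2
        exact hE u (T.no_two_cycle u h2)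
  have := key m hm le_rfl
  rw [hmu] at this
  exact this.symm

theorem IsEternal.iterate_injective (hE : T.IsEternal) (u : V) :
    Function.Injective fun k => T.F^[k] u := by
  have key : ∀ m n, m < n → T.F^[m] u ≠ T.F^[n] u := by
    intro m n hmn h
    obtain ⟨d, rfl⟩ := Nat.exists_eq_add_of_lt hmn
    rw [show m + d + 1 = (d + 1) + m by omega, Function.iterate_add_apply] at h
    exact hE.iterate_ne _ (Nat.succ_pos d) h.symm
  intro m n h
  rcases lt_trichotomy m n with h' | h' | h'
  · exact absurd h (key _ _ h')
  · exact h'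
  · exact absurd h.symm (key _ _ h')

theorem IsEternal.infinite (hE : T.IsEternal) (u : V) : Infinite V :=
  Infinite.of_injective _ (hE.iterate_injective u)

theorem exists_common_ancestor (T : OrderedFamilyTree V) (u v : V) :
    ∃ m n, T.F^[m] u = T.F^[n] v := by
  have h := T.isTree.connected.preconnected u v
  rw [SimpleGraph.reachable_iff_reflTransGen] at h
  induction h with
  | refl => exact ⟨0, 0, rfl⟩
  | @tail x y _ hadj ih =>
    obtain ⟨m, n, h⟩ := ih
    rcases (shiftGraph_adj_iff.1 hadj).2 with h' | h'
    · subst h'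
      refine ⟨m + 1, n, ?_⟩
      rw [Function.iterate_succ_apply', h, ← Function.iterate_succ_apply' T.F,
        Function.iterate_succ_apply]
    · subst h'
      exact ⟨m, n + 1, by rw [h, Function.iterate_succ_apply]⟩

/-- The next ancestors of two siblings coincide. -/
theorem iterate_add_of_lt {u v : V} {m n : ℕ} (h : T.lt (T.F^[m] u) (T.F^[n] v)) (k : ℕ) :
    T.F^[k + (m + 1)] u = T.F^[k + (n + 1)] v := by
  rw [Function.iterate_add_apply, Function.iterate_add_apply _ _ (n + 1),
    Function.iterate_succ_apply', Function.iterate_succ_apply' _ n, (T.lt_sibling _ _ h).1]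

theorem IsEternal.not_lt_iterate (hE : T.IsEternal) (u : V) (m n : ℕ) :
    ¬ T.lt (T.F^[m] u) (T.F^[n] u) := by
  intro h
  have := hE.iterate_injective u (iterate_add_of_lt h 0)
  obtain rfl : m = n := by omega
  exact T.lt_irrefl _ h

theorem IsEternal.prec_iterate (hE : T.IsEternal) (u : V) {k : ℕ} (hk : 0 < k) :
    T.Prec u (T.F^[k] u) :=
  Or.inl ⟨(hE.iterate_ne u hk).symm, k, rfl⟩

theorem IsEternal.prec_parent (hE : T.IsEternal) (u : V) : T.Prec u (T.F u) :=
  hE.prec_iterate u one_pos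

theorem prec_of_lt {u v : V} (h : T.lt u v) : T.Prec u v := Or.inr ⟨0, 0, h⟩

theorem prec_of_iterate_eq {u v : V} (h : ∃ k, T.F^[k] u = v) : u = v ∨ T.Prec u v := by
  by_cases huv : u = v
  · exact Or.inl huv
  · exact Or.inr (Or.inl ⟨huv, h⟩)

theorem IsEternal.prec_irrefl (hE : T.IsEternal) (u : V) : ¬ T.Prec u u := by
  rintro (⟨h, -⟩ | ⟨m, n, h⟩)
  · exact h rfl
  · exact hE.not_lt_iterate u m n h

/-- When both relations come from sibling pairs, compare their heights `n` and `m'` on the ancestral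
line of `v`. Above the lower pair two ancestral lines have merged, so the higher pair also separates
`u` from `w`; at equal height the sibling order is transitive. -/
theorem IsEternal.prec_trans (hE : T.IsEternal) {u v w : V} (h1 : T.Prec u v) (h2 : T.Prec v w) :
    T.Prec u w := by
  rcases h1 with ⟨h1, k, rfl⟩ | ⟨m, n, h1⟩
  · have hk : 0 < k := by
      rcases Nat.eq_zero_or_pos k with rfl | h
      · exact absurd rfl h1
      · exact h
    rcases h2 with ⟨h2, l, rfl⟩ | ⟨m, n, h2⟩
    · rw [← Function.iterate_add_apply]
      exact hE.prec_iterate u (by omega)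
    · rw [← Function.iterate_add_apply] at h2
      exact Or.inr ⟨_, _, h2⟩
  · rcases h2 with ⟨h2, l, rfl⟩ | ⟨m', n', h2⟩
    · by_cases hl : l ≤ n
      · refine Or.inr ⟨m, n - l, ?_⟩
        rwa [← Function.iterate_add_apply, Nat.sub_add_cancel hl]
      · have := iterate_add_of_lt h1 (l - (n + 1))
        rw [Nat.sub_add_cancel (by omega)] at this
        rw [← this]
        exact hE.prec_iterate u (by omega)
    · rcases lt_trichotomy n m' with h | h | h
      · have := iterate_add_of_lt h1 (m' - (n + 1))
        rw [Nat.sub_add_cancel (by omega)] at this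
        rw [← this] at h2
        exact Or.inr ⟨_, _, h2⟩
      · subst h
        exact Or.inr ⟨m, n', T.lt_trans _ _ _ h1 h2⟩
      · have := iterate_add_of_lt h2 (n - (m' + 1))
        rw [Nat.sub_add_cancel (by omega)] at this
        rw [this] at h1
        exact Or.inr ⟨_, _, h1⟩

theorem IsEternal.prec_asymm (hE : T.IsEternal) {u v : V} (h1 : T.Prec u v) : ¬ T.Prec v u :=
  fun h2 => hE.prec_irrefl u (hE.prec_trans h1 h2)

theorem IsEternal.prec_total (hE : T.IsEternal) (u v : V) :
    u = v ∨ T.Prec u v ∨ T.Prec v u := by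
  classical
  have hex := T.exists_common_ancestor u v
  obtain ⟨n, hn⟩ := Nat.find_spec hex
  have hmin := fun i => Nat.find_min (m := i) hex
  generalize Nat.find hex = m at hn hmin
  rcases m with _ | m
  · rcases prec_of_iterate_eq ⟨n, hn.symm⟩ with h | h
    · exact Or.inl h.symm
    · exact Or.inr (Or.inr h)
  rcases n with _ | n
  · rcases prec_of_iterate_eq ⟨m + 1, hn⟩ with h | h
    · exact Or.inl h
    · exact Or.inr (Or.inl h)
  rw [Function.iterate_succ_apply', Function.iterate_succ_apply'] at hn
  -- Minimality of the height `m + 1` makes the two children of the common ancestor distinct.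
  rcases T.lt_total _ _ hn (hE _) (hE _) (fun h => hmin m (Nat.lt_succ_self m) ⟨n, h⟩) with h | h
  · exact Or.inr (Or.inl (Or.inr ⟨m, n, h⟩))
  · exact Or.inr (Or.inr (Or.inr ⟨n, m, h⟩))

/-- Arcs do not cross: the parent of a vertex between `c` and the parent of `c` is at most the
parent of `c`. -/
theorem IsEternal.parent_of_between (hE : T.IsEternal) {c x : V} (h1 : T.Prec c x)
    (h2 : T.Prec x (T.F c)) : T.F x = T.F c ∨ T.Prec (T.F x) (T.F c) := by
  rcases h2 with ⟨hne, k, hk⟩ | ⟨m, n, h⟩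
  · rcases k with _ | k
    · exact absurd hk hne
    · exact prec_of_iterate_eq ⟨k, hk⟩
  · exact absurd (Or.inr ⟨m, n + 1, h⟩) (hE.prec_asymm h1)

/-! ### Neighbours in the succession order -/

theorem IsEternal.isPred_unique (hE : T.IsEternal) {u v w : V} (h1 : T.IsPred u v)
    (h2 : T.IsPred u w) : v = w := by
  rcases h1.2 w h2.1 with h | h
  · exact h.symm
  · rcases h2.2 v h1.1 with h' | h'
    · exact h'
    · exact absurd h (hE.prec_asymm h')

theorem IsEternal.isPred_of_no_between (hE : T.IsEternal) {u v : V} (h : T.Prec u v)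
    (hno : ∀ w, T.Prec u w → ¬ T.Prec w v) : T.IsPred u v := by
  refine ⟨h, fun w hw => ?_⟩
  rcases hE.prec_total w v with h | h | h
  · exact Or.inl h
  · exact absurd h (hno w hw)
  · exact Or.inr h

theorem IsEternal.isSucc_iff_isPred (hE : T.IsEternal) {u v : V} :
    T.IsSucc u v ↔ T.IsPred v u := by
  constructor
  · intro h
    refine hE.isPred_of_no_between h.1 fun w h1 h2 => ?_
    rcases h.2 w h2 with rfl | h3
    · exact hE.prec_irrefl _ h1
    · exact hE.prec_asymm h1 h3
  · intro h
    refine ⟨h.1, fun w hw => ?_⟩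
    rcases hE.prec_total w v with h' | h' | h'
    · exact Or.inl h'
    · exact Or.inr h'
    · rcases h.2 w h' with rfl | h3
      · exact absurd hw (hE.prec_irrefl _)
      · exact absurd hw (hE.prec_asymm h3)

theorem IsEternal.isPred_unique_left (hE : T.IsEternal) {u v w : V} (h1 : T.IsPred v u)
    (h2 : T.IsPred w u) : v = w := by
  rw [← hE.isSucc_iff_isPred] at h1 h2
  rcases h1.2 w h2.1 with h | h
  · exact h.symm
  · rcases h2.2 v h1.1 with h' | h'
    · exact h'
    · exact absurd h (hE.prec_asymm h')

theorem IsEternal.a_eq (hE : T.IsEternal) {u v : V} (h : T.IsPred u v) : T.a u = v := by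
  have hex : ∃ v, T.IsPred u v := ⟨v, h⟩
  rw [a, dif_pos hex]
  exact hE.isPred_unique hex.choose_spec h

theorem IsEternal.b_eq (hE : T.IsEternal) {u v : V} (h : T.IsPred u v) : T.b v = u := by
  have hex : ∃ u, T.IsSucc v u := ⟨u, hE.isSucc_iff_isPred.2 h⟩
  rw [b, dif_pos hex]
  exact hE.isPred_unique_left (hE.isSucc_iff_isPred.1 hex.choose_spec) h

theorem IsEternal.a_eq_self_or (hE : T.IsEternal) (u : V) : T.a u = u ∨ T.IsPred u (T.a u) := by
  by_cases h : ∃ v, T.IsPred u v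
  · obtain ⟨v, h⟩ := h
    exact Or.inr ((hE.a_eq h).symm ▸ h)
  · exact Or.inl (dif_neg h)

theorem IsEternal.b_eq_self_or (hE : T.IsEternal) (u : V) : T.b u = u ∨ T.IsPred (T.b u) u := by
  by_cases h : ∃ v, T.IsPred v u
  · obtain ⟨v, h⟩ := h
    exact Or.inr ((hE.b_eq h).symm ▸ h)
  · exact Or.inl (dif_neg fun ⟨v, hv⟩ => h ⟨v, hE.isSucc_iff_isPred.1 hv⟩)

/-! ### Trees with finite descendant sets -/

/-- A vertex in between splits the interval into two with fewer elements; with nothing in between,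
`u` and `v` are neighbours. -/
theorem IsEternal.exists_iterate_of_finite (hE : T.IsEternal) {u v : V}
    (hfin : {x | T.Prec u x ∧ T.Prec x v}.Finite) (h : T.Prec u v) :
    ∃ k, T.a^[k] u = v ∧ T.b^[k] v = u := by
  induction hn : {x | T.Prec u x ∧ T.Prec x v}.ncard using Nat.strong_induction_on
    generalizing u v with
  | _ n ih =>
    by_cases hx : ∃ x, T.Prec u x ∧ T.Prec x v
    · obtain ⟨x, h1, h2⟩ := hx
      have s1 : {y | T.Prec u y ∧ T.Prec y x} ⊂ {y | T.Prec u y ∧ T.Prec y v} :=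
        ⟨fun y hy => ⟨hy.1, hE.prec_trans hy.2 h2⟩,
          fun hs => hE.prec_irrefl x (hs ⟨h1, h2⟩).2⟩
      have s2 : {y | T.Prec x y ∧ T.Prec y v} ⊂ {y | T.Prec u y ∧ T.Prec y v} :=
        ⟨fun y hy => ⟨hE.prec_trans h1 hy.1, hy.2⟩,
          fun hs => hE.prec_irrefl x (hs ⟨h1, h2⟩).1⟩
      obtain ⟨k, hk1, hk2⟩ := ih _ (hn ▸ Set.ncard_lt_ncard s1 hfin) (hfin.subset s1.1) h1 rfl
      obtain ⟨l, hl1, hl2⟩ := ih _ (hn ▸ Set.ncard_lt_ncard s2 hfin) (hfin.subset s2.1) h2 rfl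
      refine ⟨l + k, ?_, ?_⟩
      · rw [Function.iterate_add_apply, hk1, hl1]
      · rw [add_comm, Function.iterate_add_apply, hl2, hk2]
    · have hp := hE.isPred_of_no_between h fun w h1 h2 => hx ⟨w, h1, h2⟩
      exact ⟨1, hE.a_eq hp, hE.b_eq hp⟩

/-- The interval lies below a common ancestor of `u` and `v`: a vertex that precedes an ancestor of
`u` without descending from it precedes `u` as well. -/
theorem IsEternal.finite_between (hE : T.IsEternal)
    (hfin : ∀ v, {w | ∃ n : ℕ, T.F^[n] w = v}.Finite) (u v : V) :
    {x | T.Prec u x ∧ T.Prec x v}.Finite := by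
  obtain ⟨m, n, h⟩ := T.exists_common_ancestor u v
  refine (hfin (T.F^[m] u)).subset fun x hx => ?_
  have hxw : T.Prec x (T.F^[m] u) := by
    rcases prec_of_iterate_eq ⟨n, h.symm⟩ with h' | h'
    · exact h' ▸ hx.2
    · exact hE.prec_trans hx.2 h'
  rcases hxw with ⟨-, h'⟩ | ⟨k, l, h'⟩
  · exact h'
  · rw [← Function.iterate_add_apply] at h'
    exact absurd (Or.inr ⟨_, _, h'⟩) (hE.prec_asymm hx.1)

theorem successionLine_natCast (o : V) (n : ℕ) : T.successionLine o n = T.a^[n] o := rfl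

theorem successionLine_neg_natCast (o : V) (n : ℕ) : T.successionLine o (-n) = T.b^[n] o := by
  rcases n with _ | n
  · rfl
  · rfl

theorem mem_range_successionLine {o v : V} :
    v ∈ Set.range (T.successionLine o) ↔ ∃ n : ℕ, T.a^[n] o = v ∨ T.b^[n] o = v := by
  constructor
  · rintro ⟨n | n, rfl⟩
    · exact ⟨n, Or.inl rfl⟩
    · exact ⟨n + 1, Or.inr rfl⟩
  · rintro ⟨n, rfl | rfl⟩
    · exact ⟨n, successionLine_natCast o n⟩
    · exact ⟨-n, successionLine_neg_natCast o n⟩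

theorem HasUniqueSuccessionLine.range_eq (h : T.HasUniqueSuccessionLine) (o : V) :
    Set.range (T.successionLine o) = Set.univ :=
  Set.eq_univ_of_forall fun v => h o v ▸ ⟨0, rfl⟩

/-- An eternal tree all of whose vertices have finitely many descendants has a unique succession
line. -/
theorem IsEternal.hasUniqueSuccessionLine (hE : T.IsEternal)
    (hfin : ∀ v, {w | ∃ n : ℕ, T.F^[n] w = v}.Finite) : T.HasUniqueSuccessionLine := by
  have key : ∀ u, Set.range (T.successionLine u) = Set.univ := by
    refine fun u => Set.eq_univ_of_forall fun v => mem_range_successionLine.2 ?_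
    rcases hE.prec_total u v with rfl | h | h
    · exact ⟨0, Or.inl rfl⟩
    · obtain ⟨k, h1, -⟩ := hE.exists_iterate_of_finite (hE.finite_between hfin u v) h
      exact ⟨k, Or.inl h1⟩
    · obtain ⟨k, -, h1⟩ := hE.exists_iterate_of_finite (hE.finite_between hfin v u) h
      exact ⟨k, Or.inr h1⟩
  exact fun u v => (key u).trans (key v).symm

/-! ### Bi-infinite succession lines -/

/-- The succession order of the eternal tree `T` is isomorphic to `ℤ`. -/
structure IsBiinfinite (T : OrderedFamilyTree V) : Prop where
  eternal : T.IsEternal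
  isPred_a : ∀ u, T.IsPred u (T.a u)
  isPred_b : ∀ u, T.IsPred (T.b u) u
  unique : T.HasUniqueSuccessionLine

theorem IsEternal.iterate_a_ge (hE : T.IsEternal) (u : V) (n : ℕ) :
    T.a^[n] u = u ∨ T.Prec u (T.a^[n] u) := by
  induction n with
  | zero => exact Or.inl rfl
  | succ n ih =>
    rw [Function.iterate_succ_apply']
    rcases hE.a_eq_self_or (T.a^[n] u) with h | h
    · rwa [h]
    · rcases ih with ih | ih
      · rw [ih] at h ⊢
        exact Or.inr h.1
      · exact Or.inr (hE.prec_trans ih h.1)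

theorem IsEternal.iterate_b_le (hE : T.IsEternal) (u : V) (n : ℕ) :
    T.b^[n] u = u ∨ T.Prec (T.b^[n] u) u := by
  induction n with
  | zero => exact Or.inl rfl
  | succ n ih =>
    rw [Function.iterate_succ_apply']
    rcases hE.b_eq_self_or (T.b^[n] u) with h | h
    · rwa [h]
    · rcases ih with ih | ih
      · rw [ih] at h ⊢
        exact Or.inr h.1
      · exact Or.inr (hE.prec_trans h.1 ih)

/-- If `a u` took its default value `u`, the line through `u` would contain nothing above `u`, yet
it must visit `F u`. -/
theorem HasUniqueSuccessionLine.isPred_a (h : T.HasUniqueSuccessionLine) (hE : T.IsEternal)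
    (u : V) : T.IsPred u (T.a u) := by
  rcases hE.a_eq_self_or u with hu | hu
  · have hp := hE.prec_parent u
    have hm : T.F u ∈ Set.range (T.successionLine u) := by rw [h.range_eq]; trivial
    obtain ⟨n, hn | hn⟩ := mem_range_successionLine.1 hm
    · rw [Function.iterate_fixed hu] at hn
      exact absurd hn.symm (hE u)
    · rcases hE.iterate_b_le u n with h' | h'
      · exact absurd (hn.symm.trans h') (hE u)
      · rw [hn] at h'
        exact absurd h' (hE.prec_asymm hp)
  · exact hu

/-- In a tree with a unique succession line, a vertex that succeeds no vertex is the minimum. -/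
theorem HasUniqueSuccessionLine.minimum (h : T.HasUniqueSuccessionLine) (hE : T.IsEternal)
    {v : V} (hv : ∀ u, ¬ T.IsPred u v) (w : V) : w = v ∨ T.Prec v w := by
  have hb : T.b v = v := (hE.b_eq_self_or v).resolve_right (hv _)
  have hm : w ∈ Set.range (T.successionLine v) := by rw [h.range_eq]; trivial
  obtain ⟨n, rfl | rfl⟩ := mem_range_successionLine.1 hm
  · exact hE.iterate_a_ge v n
  · exact Or.inl (Function.iterate_fixed hb n)

theorem HasUniqueSuccessionLine.minimum_unique (h : T.HasUniqueSuccessionLine)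
    (hE : T.IsEternal) {v w : V} (hv : ∀ u, ¬ T.IsPred u v) (hw : ∀ u, ¬ T.IsPred u w) :
    v = w := by
  rcases h.minimum hE hw v with h1 | h1
  · exact h1
  · rcases h.minimum hE hv w with h2 | h2
    · exact h2.symm
    · exact absurd h1 (hE.prec_asymm h2)

theorem HasUniqueSuccessionLine.isBiinfinite (h : T.HasUniqueSuccessionLine) (hE : T.IsEternal)
    (hv : ∀ v, ∃ u, T.IsPred u v) : T.IsBiinfinite where
  eternal := hE
  isPred_a := h.isPred_a hE
  isPred_b v := by
    obtain ⟨u, hu⟩ := hv v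
    rwa [hE.b_eq hu]
  unique := h

theorem IsBiinfinite.a_b (h : T.IsBiinfinite) (u : V) : T.a (T.b u) = u :=
  h.eternal.a_eq (h.isPred_b u)

theorem IsBiinfinite.b_a (h : T.IsBiinfinite) (u : V) : T.b (T.a u) = u :=
  h.eternal.b_eq (h.isPred_a u)

theorem IsBiinfinite.isPred_iff (h : T.IsBiinfinite) {u v : V} : T.IsPred u v ↔ T.a u = v :=
  ⟨h.eternal.a_eq, fun hv => hv ▸ h.isPred_a u⟩

theorem IsBiinfinite.isPred_iff' (h : T.IsBiinfinite) {u v : V} : T.IsPred u v ↔ T.b v = u :=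
  ⟨h.eternal.b_eq, fun hv => hv ▸ h.isPred_b v⟩

theorem IsBiinfinite.successionLine_succ (h : T.IsBiinfinite) (o : V) (n : ℤ) :
    T.successionLine o (n + 1) = T.a (T.successionLine o n) := by
  rcases n with n | n
  · exact Function.iterate_succ_apply' T.a n o
  · rw [show Int.negSucc n + 1 = -(n : ℤ) by omega, successionLine_neg_natCast]
    change _ = T.a (T.b^[n + 1] o)
    rw [Function.iterate_succ_apply', h.a_b]

theorem IsBiinfinite.successionLine_a (h : T.IsBiinfinite) (o : V) (n : ℤ) :
    T.successionLine (T.a o) n = T.successionLine o (n + 1) := by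
  rcases n with n | n
  · rfl
  · rw [show Int.negSucc n + 1 = -(n : ℤ) by omega, successionLine_neg_natCast]
    change T.b^[n + 1] (T.a o) = _
    rw [Function.iterate_succ_apply, h.b_a]

theorem IsBiinfinite.successionLine_prec (h : T.IsBiinfinite) (o : V) {i j : ℤ} (hij : i < j) :
    T.Prec (T.successionLine o i) (T.successionLine o j) := by
  induction j, (show i + 1 ≤ j from hij) using Int.leInduction with
  | base =>
    rw [h.successionLine_succ]
    exact (h.isPred_a _).1
  | succ j hj ih =>
    rw [h.successionLine_succ]
    exact h.eternal.prec_trans (ih hj) (h.isPred_a _).1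

theorem IsBiinfinite.prec_successionLine_iff (h : T.IsBiinfinite) (o : V) {i j : ℤ} :
    T.Prec (T.successionLine o i) (T.successionLine o j) ↔ i < j := by
  refine ⟨fun hp => ?_, h.successionLine_prec o⟩
  rcases lt_trichotomy i j with h' | rfl | h'
  · exact h'
  · exact absurd hp (h.eternal.prec_irrefl _)
  · exact absurd hp (h.eternal.prec_asymm (h.successionLine_prec o h'))

theorem IsBiinfinite.successionLine_bijective (h : T.IsBiinfinite) (o : V) :
    Function.Bijective (T.successionLine o) := by
  refine ⟨fun i j hij => ?_, fun v => ?_⟩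
  · rcases lt_trichotomy i j with h' | h' | h'
    · have := h.successionLine_prec o h'
      rw [hij] at this
      exact absurd this (h.eternal.prec_irrefl _)
    · exact h'
    · have := h.successionLine_prec o h'
      rw [hij] at this
      exact absurd this (h.eternal.prec_irrefl _)
  · have hm : v ∈ Set.range (T.successionLine o) := by rw [h.unique.range_eq]; trivial
    exact hm

/-! ### A local description of the succession -/

/-- Either `v` is the parent of the oldest child `u`, or the next older sibling of `u` has the
childless vertex `v` at the end of its line of youngest children. -/
def LocalPred (T : OrderedFamilyTree V) (u v : V) : Prop :=
  (T.Arc u v ∧ ∀ w, ¬ T.lt u w) ∨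
    ∃ n, T.lt u (T.F^[n] v) ∧ (∀ w, T.lt u w → ¬ T.lt w (T.F^[n] v)) ∧ (∀ w, ¬ T.Arc w v) ∧
      ∀ i < n, ∀ w, ¬ T.lt w (T.F^[i] v)

theorem IsEternal.arc_iff (hE : T.IsEternal) {u v : V} : T.Arc u v ↔ T.F u = v := by
  refine ⟨fun h => h.1, fun h => ⟨h, ?_⟩⟩
  rintro rfl
  exact hE _ h

/-- The order is a postorder traversal: after `u` comes the subtree of its next older sibling,
entered at the leaf reached through youngest children, or the parent if no older sibling remains.
Unlike `IsPred`, the right-hand side involves only vertices close to `u` and `v`. -/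
theorem IsEternal.isPred_iff_localPred (hE : T.IsEternal) {u v : V} :
    T.IsPred u v ↔ T.LocalPred u v := by
  constructor
  · rintro ⟨hp, hmin⟩
    have hno : ∀ w, T.Prec u w → ¬ T.Prec w v := by
      intro w h1 h2
      rcases hmin w h1 with rfl | h
      · exact hE.prec_irrefl _ h2
      · exact hE.prec_asymm h h2
    rcases hp with ⟨hne, k, hk⟩ | ⟨m, n, h⟩
    · rcases k with _ | _ | k
      · exact absurd hk hne
      · refine Or.inl ⟨⟨hk, hne⟩, fun w hw => ?_⟩
        refine hno w (prec_of_lt hw) ?_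
        have : T.F w = v := by rw [← (T.lt_sibling _ _ hw).1]; exact hk
        exact this ▸ hE.prec_parent w
      · refine absurd ?_ (hno _ (hE.prec_parent u))
        rw [← hk, Function.iterate_succ_apply]
        exact hE.prec_iterate _ (Nat.succ_pos k)
    · rcases m with _ | m
      · refine Or.inr ⟨n, h, fun w h1 h2 => ?_, fun w hw => ?_, fun i hi w hw => ?_⟩
        · exact hno w (prec_of_lt h1) (Or.inr ⟨0, n, h2⟩)
        · obtain ⟨rfl, -⟩ := hw
          exact hno w (Or.inr ⟨0, n + 1, h⟩) (hE.prec_parent w)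
        · refine hno w (Or.inr ⟨0, n - i, ?_⟩) (Or.inr ⟨0, i, hw⟩)
          obtain ⟨d, rfl⟩ := Nat.exists_eq_add_of_lt hi
          have : T.F^[i + d + 1 - i] w = T.F^[i + d + 1] v := by
            rw [show i + d + 1 - i = d + 1 by omega, show i + d + 1 = (d + 1) + i by omega,
              Function.iterate_add_apply _ (d + 1) i, Function.iterate_succ_apply,
              Function.iterate_succ_apply _ d (T.F^[i] v), (T.lt_sibling _ _ hw).1]
          rw [this]
          exact h
      · exact absurd (Or.inr ⟨0, n, h⟩) (hno _ (hE.prec_iterate u (Nat.succ_pos m)))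
  · rintro (⟨⟨rfl, hne⟩, hold⟩ | ⟨n, hlt, hadj, hleaf, hyoung⟩)
    · refine ⟨hE.prec_parent u, ?_⟩
      rintro w (⟨hne', k, rfl⟩ | ⟨m, l, h⟩)
      · rcases k with _ | k
        · exact absurd rfl hne'
        · rcases prec_of_iterate_eq (T := T) (u := T.F u) ⟨k, rfl⟩ with h | h
          · exact Or.inl h.symm
          · exact Or.inr h
      · rcases m with _ | m
        · exact absurd h (hold _)
        · exact Or.inr (Or.inr ⟨m, l, h⟩)
    · refine hE.isPred_of_no_between (Or.inr ⟨0, n, hlt⟩) ?_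
      have hanc : ∀ k, T.F^[k + 1] u = T.F^[k + (n + 1)] v := iterate_add_of_lt (m := 0) hlt
      rintro w (⟨hne, k, rfl⟩ | ⟨m, l, h⟩) hwv
      · rcases k with _ | k
        · exact hne rfl
        · rw [hanc] at hwv
          exact hE.prec_asymm hwv (hE.prec_iterate v (by omega))
      rcases m with _ | m
      · have hs : T.F (T.F^[l] w) = T.F (T.F^[n] v) :=
          (T.lt_sibling _ _ h).1.symm.trans (T.lt_sibling _ _ hlt).1
        -- If these older siblings of `u` coincide, `w` lies in the subtree whose least vertex is
        -- `v`; otherwise the ancestor of `w` is older than that of `v`.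
        by_cases heq : T.F^[l] w = T.F^[n] v
        · rcases hwv with ⟨hne, j, rfl⟩ | ⟨p, q, hpq⟩
          · rcases j with _ | j
            · exact hne rfl
            · exact hleaf (T.F^[j] w)
                (hE.arc_iff.2 (Function.iterate_succ_apply' T.F j w).symm)
          · rcases lt_or_ge q n with hq | hq
            · exact hyoung q hq _ hpq
            · obtain ⟨d, rfl⟩ := Nat.exists_eq_add_of_le hq
              rw [add_comm n d, Function.iterate_add_apply _ d n, ← heq,
                ← Function.iterate_add_apply] at hpq
              exact hE.not_lt_iterate w _ _ hpq
        · rcases T.lt_total _ _ hs (hE _) (hE _) heq with h' | h'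
          · exact hadj _ h h'
          · exact hE.prec_asymm hwv (Or.inr ⟨_, _, h'⟩)
      · rw [hanc] at h
        exact hE.prec_asymm hwv (Or.inr ⟨_, _, h⟩)

end OrderedFamilyTree

/-! ### Record maps of non-crossing maps -/

namespace RecordGraph

/-- The record map of `n ↦ d (n + 1) - 1`, where `d i` is the number of preimages of `i` under the
non-crossing map `π`, is `π`. -/
theorem recordMap_eq_of_noncrossing {π : ℤ → ℤ} (hlt : ∀ m, m < π m)
    (hnc : ∀ m n, m < n → n < π m → π n ≤ π m) (hfin : ∀ i, {m | π m = i}.Finite) (n : ℤ) :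
    recordMap (fun n => ({m | π m = n + 1}.ncard : ℤ) - 1) n = π n := by
  classical
  set y : ℤ → ℤ := fun n => ({m | π m = n + 1}.ncard : ℤ) - 1 with hy
  -- The partial sum counts the arcs that end in `(n, j]`, minus the length of that interval.
  have hsum : ∀ j, n < j → ∑ l ∈ Finset.Ico n j, y l =
      ({m | π m ∈ Set.Ioc n j}.ncard : ℤ) - (j - n) ∧ {m | π m ∈ Set.Ioc n j}.Finite := by
    intro j hj
    induction j, (show n + 1 ≤ j from hj) using Int.leInduction with
    | base =>
      have h1 : Finset.Ico n (n + 1) = {n} := by ext; simp; omega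
      have h2 : {m | π m ∈ Set.Ioc n (n + 1)} = {m | π m = n + 1} := by
        ext m; simp only [Set.mem_ofPred_eq, Set.mem_Ioc]; omega
      rw [h1, h2, Finset.sum_singleton]
      exact ⟨by simp [hy], hfin _⟩
    | succ j hj' ih =>
      obtain ⟨ih1, ih2⟩ := ih hj'
      have h2 : {m | π m ∈ Set.Ioc n (j + 1)} = {m | π m ∈ Set.Ioc n j} ∪ {m | π m = j + 1} := by
        ext m; simp only [Set.mem_ofPred_eq, Set.mem_Ioc, Set.mem_union]; omega
      have h3 : Disjoint {m | π m ∈ Set.Ioc n j} {m | π m = j + 1} := by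
        rw [Set.disjoint_left]
        intro m h h'
        simp only [Set.mem_ofPred_eq, Set.mem_Ioc] at h h'
        omega
      have h4 : Finset.Ico n (j + 1) = insert j (Finset.Ico n j) := by ext; simp; omega
      rw [h2, Set.ncard_union_eq h3 ih2 (hfin _), h4, Finset.sum_insert (by simp), ih1]
      refine ⟨?_, ih2.union (hfin _)⟩
      simp only [hy]
      push_cast
      ring
  have hcard : ∀ j, n ≤ j → ((Set.Ico n j).ncard : ℤ) = j - n := by
    intro j hj
    rw [← Finset.coe_Ico, Set.ncard_coe_finset, Int.card_Ico, Int.toNat_of_nonneg (by omega)]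
  -- By non-crossing, all arcs from `[n, π n)` end in `(n, π n]`, which has the same length.
  have hnonneg : 0 ≤ ∑ l ∈ Finset.Ico n (π n), y l := by
    obtain ⟨h1, h2⟩ := hsum _ (hlt n)
    have hsub : Set.Ico n (π n) ⊆ {m | π m ∈ Set.Ioc n (π n)} := by
      rintro m ⟨hm1, hm2⟩
      rcases hm1.eq_or_lt with rfl | hm
      · exact ⟨hlt _, le_rfl⟩
      · exact ⟨hm.trans (hlt m), hnc _ _ hm hm2⟩
    have h3 := Set.ncard_le_ncard hsub h2
    have h4 := hcard (π n) (hlt n).le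
    rw [h1]
    omega
  -- An arc ending in `(n, j]` starts after `n`: the arc of `n` ends beyond `j`, and one from before
  -- `n` would cross it. So at most `j - n - 1` arcs are counted.
  have hneg : ∀ j, n < j → j < π n → ∑ l ∈ Finset.Ico n j, y l < 0 := by
    intro j hj hjn
    obtain ⟨h1, h2⟩ := hsum _ hj
    have hsub : {m | π m ∈ Set.Ioc n j} ⊆ Set.Ico (n + 1) j := by
      rintro m ⟨hm1, hm2⟩
      have := hlt m
      refine ⟨?_, by omega⟩
      by_contra hcon
      rcases (show m ≤ n by omega).eq_or_lt with rfl | hm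
      · omega
      · have := hnc m n hm hm1
        omega
    have h3 := Set.ncard_le_ncard hsub (Set.finite_Ico _ _)
    have h5 : Set.Ico (n + 1) j ⊂ Set.Ico n j :=
      ⟨Set.Ico_subset_Ico_left (by omega), fun h => by
        have := h (show n ∈ Set.Ico n j from ⟨le_rfl, hj⟩)
        have := this.1
        omega⟩
    have h6 := Set.ncard_lt_ncard h5 (Set.finite_Ico _ _)
    have h4 := hcard j hj.le
    rw [h1]
    omega
  rcases recordMap_spec y n with h | ⟨h1, h2, h3⟩
  · exfalso
    have hex : ∃ j, n < j ∧ 0 ≤ ∑ l ∈ Finset.Ico n j, y l := ⟨π n, hlt n, hnonneg⟩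
    rw [recordMap, if_pos hex] at h
    have hm := Int.csInf_mem (s := {j | n < j ∧ 0 ≤ ∑ l ∈ Finset.Ico n j, y l}) hex
      ⟨n, fun j hj => hj.1.le⟩
    rw [h] at hm
    exact lt_irrefl _ hm.1
  · rcases lt_trichotomy (recordMap y n) (π n) with h | h | h
    · exact absurd h2 (not_le.2 (hneg _ h1 h))
    · exact h
    · exact absurd hnonneg (not_le.2 (h3 _ (hlt n) h))

end RecordGraph

/-! ### Recovering the tree from its offspring sequence -/

namespace OrderedFamilyTree

variable {V : Type} {T : OrderedFamilyTree V}

theorem IsEternal.numChildren_eq (hE : T.IsEternal) (w : V) :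
    T.numChildren w = {v | T.F v = w}.ncard := by
  simp only [numChildren, hE.arc_iff]

theorem IsEternal.finite_fiber (hE : T.IsEternal) (w : V) : {v | T.F v = w}.Finite :=
  (T.finite_children w).subset fun v hv => ⟨hv, by rintro rfl; exact hE _ hv⟩

/-- A tree with bi-infinite succession line is the record graph of its offspring sequence. -/
theorem IsBiinfinite.mk_eq_rootedComponent (h : T.IsBiinfinite) (o : V) :
    TreeSpace.mk ⟨V, T, ![o]⟩ = RecordGraph.rootedComponent
      fun n => (T.numChildren (T.successionLine o (n + 1)) : ℤ) - 1 := by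
  let φ : ℤ ≃ V := Equiv.ofBijective _ (h.successionLine_bijective o)
  have hφ : ∀ i, φ i = T.successionLine o i := fun _ => rfl
  have hprec : ∀ {i j}, T.Prec (φ i) (φ j) ↔ i < j := h.prec_successionLine_iff o
  -- The parent map, read in the numbering of the vertices along the succession line.
  let π : ℤ → ℤ := fun m => φ.symm (T.F (φ m))
  have hφπ : ∀ m, φ (π m) = T.F (φ m) := fun m => φ.apply_symm_apply _
  have hlt : ∀ m, m < π m := fun m => by
    rw [← hprec, hφπ]
    exact h.eternal.prec_parent _
  have hnc : ∀ m n, m < n → n < π m → π n ≤ π m := by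
    intro m n h1 h2
    rw [← hprec] at h1 h2
    rw [hφπ] at h2
    rcases h.eternal.parent_of_between h1 h2 with h3 | h3
    · rw [← hφπ, ← hφπ] at h3
      exact (φ.injective h3).le
    · rw [← hφπ, ← hφπ, hprec] at h3
      exact h3.le
  have hset : ∀ i, {m | π m = i} = φ ⁻¹' {v | T.F v = φ i} := by
    intro i
    ext m
    simp only [Set.mem_ofPred_eq, Set.mem_preimage, ← hφπ, φ.injective.eq_iff]
  have hfin : ∀ i, {m | π m = i}.Finite := fun i => by
    rw [hset]
    exact (h.eternal.finite_fiber _).preimage φ.injective.injOn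
  have hy : (fun n => (T.numChildren (T.successionLine o (n + 1)) : ℤ) - 1) =
      fun n => ({m | π m = n + 1}.ncard : ℤ) - 1 := by
    funext n
    rw [h.eternal.numChildren_eq, hset, ← hφ,
      Set.ncard_preimage_of_injective_subset_range φ.injective (by simp)]
  rw [hy]
  have hR := RecordGraph.recordMap_eq_of_noncrossing hlt hnc hfin
  generalize (fun n => ({m | π m = n + 1}.ncard : ℤ) - 1) = y at hR
  -- The record map is conjugate to the parent map of a connected tree, so the component of `0` is
  -- all of ℤ.
  have hcomp : ∀ v, φ.symm v ∈ RecordGraph.component y := by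
    intro v
    have h1 := T.isTree.connected.preconnected o v
    let f : shiftGraph T.F →g shiftGraph (RecordGraph.recordMap y) :=
      ⟨φ.symm, fun {u v} huv => by
        rw [shiftGraph_adj_iff] at huv ⊢
        refine ⟨fun hh => huv.1 (φ.symm.injective hh), ?_⟩
        rw [hR, hR]
        simp only [π, Equiv.apply_symm_apply, φ.symm.injective.eq_iff]
        exact huv.2⟩
    have h2 := h1.map f
    have h3 : f o = 0 := (φ.symm_apply_eq).2 rfl
    rw [h3] at h2
    exact h2
  let e : V ≃ RecordGraph.component y :=
    ⟨fun v => ⟨φ.symm v, hcomp v⟩, fun i => φ i, fun v => φ.apply_symm_apply v,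
      fun i => Subtype.ext (φ.symm_apply_apply i)⟩
  have heF : ∀ u, e (T.F u) = RecordGraph.componentMap y (e u) := fun u => Subtype.ext (by
    change φ.symm (T.F u) = RecordGraph.recordMap y (φ.symm u)
    rw [hR]
    simp [π])
  refine Quotient.sound ⟨e, heF, fun u v => ?_, fun i => ?_⟩
  · change T.lt u v ↔ RecordGraph.componentMap y (e u) = RecordGraph.componentMap y (e v) ∧
      RecordGraph.componentMap y (e u) ≠ e u ∧ RecordGraph.componentMap y (e v) ≠ e v ∧
        φ.symm u < φ.symm v
    simp only [← heF, ne_eq, e.injective.eq_iff]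
    have hp : φ.symm u < φ.symm v ↔ T.Prec u v := by
      rw [← hprec, φ.apply_symm_apply, φ.apply_symm_apply]
    rw [hp]
    refine ⟨fun huv => ⟨(T.lt_sibling _ _ huv).1, h.eternal u, h.eternal v, prec_of_lt huv⟩, ?_⟩
    rintro ⟨h1, h2, h3, h4⟩
    have hne : u ≠ v := by
      rintro rfl
      exact h.eternal.prec_irrefl _ h4
    rcases T.lt_total u v h1 h2 h3 hne with h5 | h5
    · exact h5
    · exact absurd h4 (h.eternal.prec_asymm (prec_of_lt h5))
  · fin_cases i
    exact Subtype.ext ((φ.symm_apply_eq).2 rfl)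

end OrderedFamilyTree

/-! ### Neighbourhoods for the graph distance -/

namespace OrderedFamilyTree

variable {V : Type} {T : OrderedFamilyTree V}

/-- The vertices at graph distance at most `s` from `w`. -/
def near (T : OrderedFamilyTree V) (w : V) (s : ℕ) : Set V := {x | (shiftGraph T.F).dist x w ≤ s}

theorem shiftGraph_adj_iff_arc {u v : V} :
    (shiftGraph T.F).Adj u v ↔ T.Arc u v ∨ T.Arc v u := by
  rw [shiftGraph_adj_iff, Arc, Arc]
  constructor
  · rintro ⟨h, h' | h'⟩
    · exact Or.inl ⟨h', h⟩
    · exact Or.inr ⟨h', h.symm⟩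
  · rintro (⟨h', h⟩ | ⟨h', h⟩)
    · exact ⟨h, Or.inl h'⟩
    · exact ⟨h.symm, Or.inr h'⟩

theorem near_trans {u v w : V} {s t : ℕ} (h1 : u ∈ T.near v s) (h2 : v ∈ T.near w t) :
    u ∈ T.near w (s + t) :=
  (T.isTree.connected.dist_triangle).trans (add_le_add h1 h2)

theorem near_of_adj {u v : V} (h : (shiftGraph T.F).Adj u v) : u ∈ T.near v 1 :=
  (SimpleGraph.dist_eq_one_iff_adj.2 h).le

theorem self_mem_near (w : V) (s : ℕ) : w ∈ T.near w s := by
  simp [near]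

theorem near_mono {w : V} {s t : ℕ} (h : s ≤ t) : T.near w s ⊆ T.near w t :=
  fun _ hx => le_trans hx h

theorem mem_near_zero {x w : V} (h : x ∈ T.near w 0) : x = w :=
  (T.isTree.connected.dist_eq_zero_iff).1 (Nat.le_zero.1 h)

theorem near_succ {x w : V} {s : ℕ} (h : x ∈ T.near w (s + 1)) :
    x ∈ T.near w s ∨ ∃ z ∈ T.near w s, (shiftGraph T.F).Adj x z := by
  by_cases hs : (shiftGraph T.F).dist x w ≤ s
  · exact Or.inl hs
  · right
    obtain ⟨p, hp⟩ := T.isTree.connected.exists_walk_length_eq_dist x w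
    have hle : (shiftGraph T.F).dist x w ≤ s + 1 := h
    cases p with
    | nil => simp at hs
    | @cons _ z _ hadj p =>
      refine ⟨z, ?_, hadj⟩
      have := SimpleGraph.dist_le p
      rw [SimpleGraph.Walk.length_cons] at hp
      change (shiftGraph T.F).dist z w ≤ s
      omega

end OrderedFamilyTree

/-! ### Isomorphisms of balls -/

namespace RootedOFT

variable {k m : ℕ} {G H K : RootedOFT k} {R : ℕ}

theorem root_mem_ball (G : RootedOFT k) (i : Fin k) (r : ℕ) : G.root i ∈ G.ball r :=
  ⟨i, OrderedFamilyTree.self_mem_near _ _⟩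

theorem mem_ball_of_near {x w : G.V} {d s : ℕ} (hx : x ∈ G.T.near w s) (hw : w ∈ G.ball d)
    (h : s + d ≤ R) : x ∈ G.ball R := by
  obtain ⟨i, hi⟩ := hw
  exact ⟨i, OrderedFamilyTree.near_mono h (OrderedFamilyTree.near_trans hx hi)⟩

/-- An isomorphism between the balls of radius `R`. -/
structure BallEquiv (R : ℕ) (G H : RootedOFT k) where
  e : G.ball R ≃ H.ball R
  arc : ∀ u v : G.ball R, G.T.Arc u v ↔ H.T.Arc (e u) (e v)
  lt : ∀ u v : G.ball R, G.T.lt u v ↔ H.T.lt (e u) (e v)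
  root : ∀ (u : G.ball R) (i : Fin k), (u : G.V) = G.root i ↔ (e u : H.V) = H.root i

theorem ballIso_iff : BallIso R G H ↔ Nonempty (BallEquiv R G H) :=
  ⟨fun ⟨e, h1, h2, h3⟩ => ⟨⟨e, h1, h2, h3⟩⟩, fun ⟨⟨e, h1, h2, h3⟩⟩ => ⟨e, h1, h2, h3⟩⟩

namespace BallEquiv

/-- The inverse isomorphism. -/
def symm (E : BallEquiv R G H) : BallEquiv R H G where
  e := E.e.symm
  arc u v := by rw [E.arc, E.e.apply_symm_apply, E.e.apply_symm_apply]
  lt u v := by rw [E.lt, E.e.apply_symm_apply, E.e.apply_symm_apply]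
  root u i := by rw [E.root, E.e.apply_symm_apply]

theorem e_symm_e (E : BallEquiv R G H) (x : H.ball R) : E.e (E.symm.e x) = x :=
  E.e.apply_symm_apply x

theorem symm_e_e (E : BallEquiv R G H) (x : G.ball R) : E.symm.e (E.e x) = x :=
  E.e.symm_apply_apply x

/-- The composition of two isomorphisms. -/
def trans (E : BallEquiv R G H) (E' : BallEquiv R H K) : BallEquiv R G K where
  e := E.e.trans E'.e
  arc u v := by rw [E.arc, E'.arc]; rfl
  lt u v := by rw [E.lt, E'.lt]; rfl
  root u i := by rw [E.root, E'.root]; rfl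

theorem e_root (E : BallEquiv R G H) (i : Fin k) :
    (E.e ⟨G.root i, G.root_mem_ball i R⟩ : H.V) = H.root i :=
  (E.root _ i).1 rfl

theorem adj (E : BallEquiv R G H) {u v : G.ball R} (h : (shiftGraph G.T.F).Adj u v) :
    (shiftGraph H.T.F).Adj (E.e u) (E.e v) := by
  rw [OrderedFamilyTree.shiftGraph_adj_iff_arc] at h ⊢
  rwa [← E.arc, ← E.arc]

/-- Distances are those of the whole tree, so a geodesic to `w` must stay in the domain of `E` to be
carried over; `hs` guarantees this. -/
theorem near_map (E : BallEquiv R G H) {w : G.ball R} {s : ℕ} (hs : G.T.near w s ⊆ G.ball R)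
    {x : G.ball R} (hx : (x : G.V) ∈ G.T.near w s) : (E.e x : H.V) ∈ H.T.near (E.e w) s := by
  induction s generalizing x with
  | zero =>
    obtain rfl : x = w := Subtype.ext (OrderedFamilyTree.mem_near_zero hx)
    exact OrderedFamilyTree.self_mem_near _ _
  | succ s ih =>
    have hs' := (OrderedFamilyTree.near_mono (T := G.T) (w := w) (Nat.le_succ s)).trans hs
    rcases OrderedFamilyTree.near_succ hx with h | ⟨z, hz, hadj⟩
    · exact OrderedFamilyTree.near_mono (Nat.le_succ s) (ih hs' h)
    · have h1 := ih hs' (x := ⟨z, hs' hz⟩) hz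
      have h2 := OrderedFamilyTree.near_of_adj (E.adj (u := x) (v := ⟨z, hs' hz⟩) hadj)
      rw [add_comm]
      exact OrderedFamilyTree.near_trans h2 h1

theorem ball_map (E : BallEquiv R G H) {d : ℕ} (hd : d ≤ R) {x : G.ball R}
    (hx : (x : G.V) ∈ G.ball d) : (E.e x : H.V) ∈ H.ball d := by
  obtain ⟨i, hi⟩ := hx
  refine ⟨i, ?_⟩
  have := E.near_map (w := ⟨G.root i, G.root_mem_ball i R⟩) (s := d)
    (fun y hy => ⟨i, OrderedFamilyTree.near_mono hd hy⟩) (x := x) hi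
  rwa [E.e_root] at this

/-- Isomorphic balls remain isomorphic, with smaller radius, around new roots inside them. -/
theorem reroot (E : BallEquiv R G H) {r d : ℕ} (hr : r + d ≤ R) (ρ : Fin m → G.ball R)
    (hρ : ∀ i, (ρ i : G.V) ∈ G.ball d) :
    BallIso r ⟨G.V, G.T, fun i => ρ i⟩ ⟨H.V, H.T, fun i => E.e (ρ i)⟩ := by
  -- Stated for arbitrary trees so that it also applies to `E.symm`.
  have sub : ∀ {G H : RootedOFT k} (E : BallEquiv R G H) (ρ : Fin m → G.ball R)
      (hρ : ∀ i, (ρ i : G.V) ∈ G.ball d) (x : G.ball R) (i),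
      (x : G.V) ∈ G.T.near (ρ i) r → (E.e x : H.V) ∈ H.T.near (E.e (ρ i)) r := by
    intro G H E ρ hρ x i hx
    exact E.near_map (fun y hy => mem_ball_of_near hy (hρ i) hr) hx
  have hσ : ∀ i, (E.e (ρ i) : H.V) ∈ H.ball d := fun i => E.ball_map (by omega) (hρ i)
  have hG : ∀ x, x ∈ ball ⟨G.V, G.T, fun i => ρ i⟩ r → x ∈ G.ball R :=
    fun x ⟨i, hi⟩ => mem_ball_of_near hi (hρ i) hr
  have hH : ∀ x, x ∈ ball ⟨H.V, H.T, fun i => E.e (ρ i)⟩ r → x ∈ H.ball R :=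
    fun x ⟨i, hi⟩ => mem_ball_of_near hi (hσ i) hr
  let f : ball ⟨G.V, G.T, fun i => ρ i⟩ r ≃ ball ⟨H.V, H.T, fun i => E.e (ρ i)⟩ r :=
    { toFun := fun x => ⟨E.e ⟨x, hG x x.2⟩, by
        obtain ⟨i, hi⟩ := x.2
        exact ⟨i, sub E ρ hρ ⟨x, _⟩ i hi⟩⟩
      invFun := fun x => ⟨E.symm.e ⟨x, hH x x.2⟩, by
        obtain ⟨i, hi⟩ := x.2
        refine ⟨i, ?_⟩
        have := sub E.symm (fun i => E.e (ρ i)) hσ ⟨x, hH x x.2⟩ i hi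
        rwa [E.symm_e_e] at this⟩
      left_inv := fun x => by
        apply Subtype.ext
        have := congrArg Subtype.val (E.symm_e_e ⟨x, hG x x.2⟩)
        exact this
      right_inv := fun x => by
        apply Subtype.ext
        have := congrArg Subtype.val (E.e_symm_e ⟨x, hH x x.2⟩)
        exact this }
  refine ⟨f, fun u v => E.arc ⟨u, hG u u.2⟩ ⟨v, hG v v.2⟩,
    fun u v => E.lt ⟨u, hG u u.2⟩ ⟨v, hG v v.2⟩, fun u i => ?_⟩
  change (u : G.V) = ρ i ↔ (E.e ⟨u, hG u u.2⟩ : H.V) = E.e (ρ i)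
  rw [← Subtype.ext_iff, E.e.injective.eq_iff, Subtype.ext_iff]

theorem mem_ball_of_adj {x w : G.V} {d : ℕ} (hw : w ∈ G.ball d)
    (h : (shiftGraph G.T.F).Adj x w) : x ∈ G.ball (d + 1) :=
  mem_ball_of_near (OrderedFamilyTree.near_of_adj h) hw (by omega)

theorem mem_ball_mono {x : G.V} {d e : ℕ} (h : d ≤ e) (hx : x ∈ G.ball d) : x ∈ G.ball e :=
  mem_ball_of_near (OrderedFamilyTree.self_mem_near x 0) hx (by omega)

theorem parent_mem_ball {w : G.V} {d : ℕ} (hw : w ∈ G.ball d) : G.T.F w ∈ G.ball (d + 1) := by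
  by_cases h : G.T.F w = w
  · rw [h]
    exact mem_ball_mono (Nat.le_succ d) hw
  · exact mem_ball_of_adj hw
      (OrderedFamilyTree.shiftGraph_adj_iff_arc.2 (Or.inr ⟨rfl, fun h' => h h'.symm⟩))

theorem iterate_mem_ball {w : G.V} {d : ℕ} (hw : w ∈ G.ball d) (n : ℕ) :
    G.T.F^[n] w ∈ G.ball (d + n) := by
  induction n with
  | zero => exact hw
  | succ n ih =>
    rw [Function.iterate_succ_apply']
    exact parent_mem_ball ih

theorem child_mem_ball {x w : G.V} {d : ℕ} (hw : w ∈ G.ball d) (h : G.T.Arc x w) :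
    x ∈ G.ball (d + 1) :=
  mem_ball_of_adj hw (OrderedFamilyTree.shiftGraph_adj_iff_arc.2 (Or.inl h))

theorem sibling_mem_ball {x w : G.V} {d : ℕ} (hw : w ∈ G.ball d)
    (h : G.T.F w = G.T.F x) (hx : G.T.F x ≠ x) : x ∈ G.ball (d + 2) :=
  child_mem_ball (parent_mem_ball hw) ⟨h.symm, fun h' => hx (h.symm.trans h'.symm)⟩

theorem e_parent (E : BallEquiv R G H) {w : G.ball R} {d : ℕ} (hw : (w : G.V) ∈ G.ball d)
    (hd : d + 1 ≤ R) (h : G.T.F w ∈ G.ball R) : (E.e ⟨G.T.F w, h⟩ : H.V) = H.T.F (E.e w) := by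
  by_cases hF : G.T.F w = w
  · have hw' : (⟨G.T.F w, h⟩ : G.ball R) = w := Subtype.ext hF
    rw [hw']
    -- Here `F w = w` is the default value. A genuine parent of the image would lie in the ball, as
    -- `d + 1 ≤ R`, and pull back to a parent of `w`.
    by_contra hcon
    have h1 : H.T.F (E.e w) ∈ H.ball R :=
      mem_ball_mono hd (parent_mem_ball (E.ball_map (by omega) hw))
    have h2 : H.T.Arc (E.e w) (E.e (E.symm.e ⟨_, h1⟩)) := by
      rw [E.e_symm_e]
      exact ⟨rfl, hcon⟩
    rw [← E.arc] at h2
    exact h2.2 (hF.symm.trans h2.1)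
  · have h1 : G.T.Arc w (⟨G.T.F w, h⟩ : G.ball R) := ⟨rfl, fun h' => hF h'.symm⟩
    rw [E.arc] at h1
    exact h1.1.symm

theorem e_iterate (E : BallEquiv R G H) {w : G.ball R} {d n : ℕ} (hw : (w : G.V) ∈ G.ball d)
    (hd : d + n ≤ R) (h : G.T.F^[n] w ∈ G.ball R) :
    (E.e ⟨G.T.F^[n] w, h⟩ : H.V) = H.T.F^[n] (E.e w) := by
  induction n with
  | zero => rfl
  | succ n ih =>
    have h1 := iterate_mem_ball hw n
    have h2 : G.T.F^[n] w ∈ G.ball R := mem_ball_mono (by omega) h1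
    rw [Function.iterate_succ_apply' H.T.F, ← ih (by omega) h2,
      ← E.e_parent (w := ⟨_, h2⟩) h1 (by omega)
        (mem_ball_mono (by omega) (parent_mem_ball h1))]
    exact congrArg _ (congrArg _ (Subtype.ext (Function.iterate_succ_apply' G.T.F n w)))

end BallEquiv

theorem BallIso.symm (h : BallIso R G H) : BallIso R H G :=
  let ⟨E⟩ := ballIso_iff.1 h
  ballIso_iff.2 ⟨E.symm⟩

theorem BallIso.trans (h : BallIso R G H) (h' : BallIso R H K) : BallIso R G K :=
  let ⟨E⟩ := ballIso_iff.1 h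
  let ⟨E'⟩ := ballIso_iff.1 h'
  ballIso_iff.2 ⟨E.trans E'⟩

theorem BallIso.mono (h : BallIso R G H) {r : ℕ} (hr : r ≤ R) : BallIso r G H := by
  obtain ⟨E⟩ := ballIso_iff.1 h
  have := E.reroot (r := r) (d := 0) (by omega) (fun i => ⟨G.root i, G.root_mem_ball i R⟩)
    fun i => G.root_mem_ball i 0
  simpa only [E.e_root] using this

theorem Iso.ballIso (h : Iso G H) (r : ℕ) : BallIso r G H := by
  obtain ⟨e, hF, hlt, hroot⟩ := h
  have harc : ∀ u v, G.T.Arc u v ↔ H.T.Arc (e u) (e v) := fun u v => by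
    simp only [OrderedFamilyTree.Arc, ← hF, ne_eq, e.injective.eq_iff]
  let i : shiftGraph G.T.F ≃g shiftGraph H.T.F :=
    ⟨e, fun {u v} => by
      rw [OrderedFamilyTree.shiftGraph_adj_iff_arc, OrderedFamilyTree.shiftGraph_adj_iff_arc,
        harc, harc]⟩
  have hdist : ∀ u v, (shiftGraph H.T.F).dist (e u) (e v) = (shiftGraph G.T.F).dist u v := by
    have aux : ∀ {V W : Type} {A : SimpleGraph V} {B : SimpleGraph W} (_ : A.Connected)
        (f : A →g B) (u v : V), B.dist (f u) (f v) ≤ A.dist u v := by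
      intro V W A B hA f u v
      obtain ⟨p, hp⟩ := hA.exists_walk_length_eq_dist u v
      rw [← hp, ← SimpleGraph.Walk.length_map f p]
      exact SimpleGraph.dist_le _
    intro u v
    refine le_antisymm (aux G.T.isTree.connected i.toHom u v) ?_
    have := aux H.T.isTree.connected i.symm.toHom (e u) (e v)
    have h1 : ∀ u, i.symm.toHom (e u) = u := fun u => e.symm_apply_apply u
    rwa [h1, h1] at this
  have hball : ∀ u, u ∈ G.ball r ↔ e u ∈ H.ball r := fun u => by
    simp only [ball, Set.mem_ofPred_eq, ← hroot, hdist]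
  refine ⟨e.subtypeEquiv hball, fun u v => harc _ _, fun u v => hlt _ _, fun u i => ?_⟩
  change (u : G.V) = _ ↔ e u = _
  rw [← hroot, e.injective.eq_iff]

/-! ### Local properties -/

/-- A property of rooted trees is local if it can be read off a ball. -/
def IsLocal (S : RootedOFT k → Prop) : Prop :=
  ∀ G, S G → ∃ r, ∀ H, BallIso r G H → S H

theorem IsLocal.and {S S' : RootedOFT k → Prop} (h : IsLocal S) (h' : IsLocal S') :
    IsLocal fun G => S G ∧ S' G := by
  rintro G ⟨hG, hG'⟩
  obtain ⟨r, hr⟩ := h G hG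
  obtain ⟨r', hr'⟩ := h' G hG'
  exact ⟨max r r', fun H hH => ⟨hr H (hH.mono (le_max_left _ _)), hr' H (hH.mono (le_max_right _ _))⟩⟩

theorem isLocal_ballIso (r : ℕ) (G : RootedOFT k) : IsLocal fun H => BallIso r H G :=
  fun _ hH => ⟨r, fun _ hK => hK.symm.trans hH⟩

theorem exists_mem_ball (G : RootedOFT (k + 1)) (w : G.V) : ∃ d, w ∈ G.ball d :=
  ⟨_, 0, le_rfl⟩

/-- The tree `G` with the root `v` only. -/
def withRoot (G : RootedOFT k) (v : G.V) : RootedOFT 1 := ⟨G.V, G.T, ![v]⟩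

/-- The tree `G` with the roots `u` and `v`. -/
def withRoots (G : RootedOFT k) (u v : G.V) : RootedOFT 2 := ⟨G.V, G.T, ![u, v]⟩

theorem withRoot_root (G : RootedOFT 1) : G.withRoot (G.root 0) = G := by
  obtain ⟨V, T, o⟩ := G
  have : ![o 0] = o := by
    funext i
    fin_cases i
    rfl
  simp only [withRoot, this]

theorem IsLocal.second {S : RootedOFT 1 → Prop} (h : IsLocal S) :
    IsLocal fun G : RootedOFT 2 => S (G.withRoot (G.root 1)) := by
  intro G hG
  obtain ⟨r, hr⟩ := h _ hG
  refine ⟨r, fun H hH => hr _ ?_⟩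
  obtain ⟨E⟩ := ballIso_iff.1 hH
  have := E.reroot (m := 1) (r := r) (d := 0) (by omega)
    ![⟨G.root 1, G.root_mem_ball 1 r⟩] fun i => by
      fin_cases i
      exact G.root_mem_ball 1 0
  convert this using 2
  · refine congrArg (RootedOFT.mk G.V G.T) (funext fun i => ?_)
    fin_cases i
    rfl
  · refine congrArg (RootedOFT.mk H.V H.T) (funext fun i => ?_)
    fin_cases i
    exact (E.e_root 1).symm

/-- A witness at distance `d` from the root is certified by the ball of radius `r + d`. As `d` is
not bounded in advance, the radius in `IsLocal` has to depend on the tree. -/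
theorem IsLocal.exists {S : RootedOFT 2 → Prop} (h : IsLocal S) :
    IsLocal fun G : RootedOFT 1 => ∃ v, S (G.withRoots (G.root 0) v) := by
  rintro G ⟨v, hG⟩
  obtain ⟨r, hr⟩ := h _ hG
  obtain ⟨d, hd⟩ := G.exists_mem_ball v
  have hd' : v ∈ G.ball (r + d) := BallEquiv.mem_ball_mono (by omega) hd
  refine ⟨r + d, fun H hH => ?_⟩
  obtain ⟨E⟩ := ballIso_iff.1 hH
  refine ⟨E.e ⟨v, hd'⟩, hr _ ?_⟩
  have := E.reroot (m := 2) (r := r) (d := d) le_rfl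
    ![⟨G.root 0, G.root_mem_ball 0 _⟩, ⟨v, hd'⟩] fun i => by
      fin_cases i
      · exact G.root_mem_ball 0 d
      · exact hd
  convert this using 2
  · refine congrArg (RootedOFT.mk G.V G.T) (funext fun i => ?_)
    fin_cases i <;> rfl
  · refine congrArg (RootedOFT.mk H.V H.T) (funext fun i => ?_)
    fin_cases i
    · exact (E.e_root 0).symm
    · rfl

theorem isLocal_numChildren (i : Fin k) (c : ℕ) :
    IsLocal fun G : RootedOFT k => G.T.numChildren (G.root i) = c := by
  rintro G rfl
  refine ⟨1, fun H hH => ?_⟩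
  obtain ⟨E⟩ := ballIso_iff.1 hH
  have hG : ∀ v, G.T.Arc v (G.root i) → v ∈ G.ball 1 := fun v hv =>
    BallEquiv.child_mem_ball (G.root_mem_ball i 0) hv
  have hH' : ∀ v, H.T.Arc v (H.root i) → v ∈ H.ball 1 := fun v hv =>
    BallEquiv.child_mem_ball (H.root_mem_ball i 0) hv
  refine (Set.ncard_congr (fun v hv => (E.e ⟨v, hG v hv⟩ : H.V)) ?_ ?_ ?_).symm
  · intro v hv
    change H.T.Arc _ _
    rw [← E.e_root i, ← E.arc]
    exact hv
  · intro u v hu hv huv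
    exact congrArg Subtype.val (E.e.injective (Subtype.ext huv))
  · intro w hw
    refine ⟨E.symm.e ⟨w, hH' w hw⟩, ?_, ?_⟩
    · change G.T.Arc _ _
      rw [← E.symm.e_root i, ← E.symm.arc]
      exact hw
    · exact congrArg Subtype.val (E.e_symm_e ⟨w, hH' w hw⟩)

/-- The radius `n + 2` reaches the siblings of `F^[n] v`, through their parent. Hence any vertex of
`H` that could violate a negative clause lies in the ball and pulls back to `G`. -/
theorem BallEquiv.localPred (E : BallEquiv R G H) {u v : G.ball R} (n : ℕ)
    (hu : (u : G.V) ∈ G.ball 0) (hv : (v : G.V) ∈ G.ball 0) (hR : n + 2 ≤ R)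
    (h : (G.T.Arc u v ∧ ∀ w, ¬ G.T.lt u w) ∨
      (G.T.lt u (G.T.F^[n] v) ∧ (∀ w, G.T.lt u w → ¬ G.T.lt w (G.T.F^[n] v)) ∧
        (∀ w, ¬ G.T.Arc w v) ∧ ∀ i < n, ∀ w, ¬ G.T.lt w (G.T.F^[i] v))) :
    H.T.LocalPred (E.e u) (E.e v) := by
  have hu' := E.ball_map (Nat.zero_le R) hu
  have hv' := E.ball_map (Nat.zero_le R) hv
  have hit : ∀ i ≤ n, G.T.F^[i] v ∈ G.ball R := fun i hi =>
    mem_ball_mono (by omega) (iterate_mem_ball hv i)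
  have hsib : ∀ w, H.T.lt (E.e u) w → w ∈ H.ball R := fun w hw =>
    mem_ball_mono (by omega) (sibling_mem_ball hu' (H.T.lt_sibling _ _ hw).1
      (H.T.lt_sibling _ _ hw).2.2)
  have hsib' : ∀ i ≤ n, ∀ w, H.T.lt w (H.T.F^[i] (E.e v)) → w ∈ H.ball R := fun i hi w hw =>
    mem_ball_mono (by omega) (sibling_mem_ball (iterate_mem_ball hv' i)
      (H.T.lt_sibling _ _ hw).1.symm (H.T.lt_sibling _ _ hw).2.1)
  have hchild : ∀ w, H.T.Arc w (E.e v) → w ∈ H.ball R := fun w hw =>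
    mem_ball_mono (by omega) (child_mem_ball hv' hw)
  have hFi : ∀ i (hi : i ≤ n), (E.e ⟨G.T.F^[i] v, hit i hi⟩ : H.V) = H.T.F^[i] (E.e v) :=
    fun i hi => E.e_iterate hv (by omega) _
  have lift : ∀ w (hw : w ∈ H.ball R), ∃ x : G.ball R, (E.e x : H.V) = w := fun w hw =>
    ⟨E.symm.e ⟨w, hw⟩, congrArg Subtype.val (E.e_symm_e ⟨w, hw⟩)⟩
  rcases h with ⟨h1, h2⟩ | ⟨h1, h2, h3, h4⟩
  · refine Or.inl ⟨(E.arc u v).1 h1, fun w hw => ?_⟩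
    obtain ⟨x, rfl⟩ := lift w (hsib w hw)
    exact h2 x ((E.lt u x).2 hw)
  · refine Or.inr ⟨n, ?_, fun w hw hw' => ?_, fun w hw => ?_, fun i hi w hw => ?_⟩
    · rw [← hFi n le_rfl, ← E.lt]
      exact h1
    · obtain ⟨x, rfl⟩ := lift w (hsib w hw)
      rw [← hFi n le_rfl, ← E.lt] at hw'
      exact h2 x ((E.lt u x).2 hw) hw'
    · obtain ⟨x, rfl⟩ := lift w (hchild w hw)
      exact h3 x ((E.arc x v).2 hw)
    · obtain ⟨x, rfl⟩ := lift w (hsib' i hi.le w hw)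
      rw [← hFi i hi.le, ← E.lt] at hw
      exact h4 i hi x hw

theorem isLocal_localPred (i j : Fin k) :
    IsLocal fun G : RootedOFT k => G.T.LocalPred (G.root i) (G.root j) := by
  intro G h
  have key : ∀ n, ((G.T.Arc (G.root i) (G.root j) ∧ ∀ w, ¬ G.T.lt (G.root i) w) ∨
      (G.T.lt (G.root i) (G.T.F^[n] (G.root j)) ∧
        (∀ w, G.T.lt (G.root i) w → ¬ G.T.lt w (G.T.F^[n] (G.root j))) ∧
        (∀ w, ¬ G.T.Arc w (G.root j)) ∧ ∀ l < n, ∀ w, ¬ G.T.lt w (G.T.F^[l] (G.root j)))) →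
      ∃ r, ∀ H, BallIso r G H → H.T.LocalPred (H.root i) (H.root j) := by
    refine fun n h => ⟨n + 2, fun H hH => ?_⟩
    obtain ⟨E⟩ := ballIso_iff.1 hH
    have := E.localPred (u := ⟨_, G.root_mem_ball i _⟩) (v := ⟨_, G.root_mem_ball j _⟩) n
      (G.root_mem_ball i 0) (G.root_mem_ball j 0) le_rfl h
    rwa [E.e_root, E.e_root] at this
  rcases h with h | ⟨n, h⟩
  · exact key 0 (Or.inl h)
  · exact key n (Or.inr h)

end RootedOFT

/-! ### Local properties define open sets -/

namespace TreeSpace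

open RootedOFT

variable {k : ℕ}

theorem mk_rep (q : TreeSpace k) : mk q.rep = q := Quotient.out_eq q

theorem iso_rep_mk (G : RootedOFT k) : Iso (mk G).rep G := Quotient.mk_out G

/-- Isomorphic trees have isomorphic balls of every radius, so the choice of a representative is
harmless for local properties. -/
theorem _root_.RootedOFT.IsLocal.rep_mk {S : RootedOFT k → Prop} (h : IsLocal S)
    (G : RootedOFT k) : S (mk G).rep ↔ S G := by
  constructor
  · intro hS
    obtain ⟨r, hr⟩ := h _ hS
    exact hr _ ((iso_rep_mk G).ballIso r)
  · intro hS
    obtain ⟨r, hr⟩ := h _ hS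
    exact hr _ ((iso_rep_mk G).ballIso r).symm

theorem isOpen_of_isLocal {S : RootedOFT k → Prop} (h : IsLocal S) :
    IsOpen {q : TreeSpace k | S q.rep} := by
  rw [isOpen_iff_forall_mem_open]
  intro q hq
  obtain ⟨r, hr⟩ := h _ hq
  refine ⟨mk '' {H | BallIso r H q.rep}, ?_, TopologicalSpace.isOpen_generateFrom_of_mem
    ⟨r, q.rep, rfl⟩, ⟨q.rep, (Iso.ballIso (iso_equivalence.refl _) r), mk_rep q⟩⟩
  rintro _ ⟨H, hH, rfl⟩
  exact (h.rep_mk H).2 (hr H hH.symm)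

theorem measurableSet_of_isLocal {S : RootedOFT k → Prop} (h : IsLocal S) :
    MeasurableSet {q : TreeSpace k | S q.rep} :=
  (isOpen_of_isLocal h).measurableSet

/-- The map `[T, u, v] ↦ [T, v]`. -/
noncomputable def second (q : TreeSpace 2) : TreeSpace 1 := mk (q.rep.withRoot (q.rep.root 1))

theorem second_mk (G : RootedOFT 2) : second (mk G) = mk (G.withRoot (G.root 1)) := by
  obtain ⟨e, h1, h2, h3⟩ := iso_rep_mk G
  refine Quotient.sound ⟨e, h1, h2, fun i => ?_⟩
  fin_cases i
  exact h3 1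

theorem continuous_second : Continuous second := by
  refine continuous_generateFrom_iff.2 ?_
  rintro _ ⟨r, G, rfl⟩
  convert isOpen_of_isLocal (isLocal_ballIso r G).second using 1
  ext q
  constructor
  · rintro ⟨H, hH, hq⟩
    have := (isLocal_ballIso r G).rep_mk H
    rw [hq] at this
    exact ((isLocal_ballIso r G).rep_mk _).1 (this.2 hH)
  · intro hq
    exact ⟨_, hq, rfl⟩

end TreeSpace

/-! ### Walking along the succession line by local steps -/

namespace RootedOFT

/-- `n` steps along the relation `Q` lead from the root to a vertex with the property `S`. -/
def iterStep (Q : RootedOFT 2 → Prop) (S : RootedOFT 1 → Prop) : ℕ → RootedOFT 1 → Prop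
  | 0, G => S G
  | n + 1, G => ∃ v, Q (G.withRoots (G.root 0) v) ∧ iterStep Q S n (G.withRoot v)

theorem IsLocal.iterStep {Q : RootedOFT 2 → Prop} {S : RootedOFT 1 → Prop} (hQ : IsLocal Q)
    (hS : IsLocal S) (n : ℕ) : IsLocal (iterStep Q S n) := by
  induction n with
  | zero => exact hS
  | succ n ih => exact IsLocal.exists (hQ.and ih.second)

/-- The second root follows the first one. -/
def Forward (G : RootedOFT 2) : Prop := G.T.LocalPred (G.root 0) (G.root 1)

/-- The first root follows the second one. -/
def Backward (G : RootedOFT 2) : Prop := G.T.LocalPred (G.root 1) (G.root 0)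

theorem isLocal_forward : IsLocal Forward := isLocal_localPred 0 1

theorem isLocal_backward : IsLocal Backward := isLocal_localPred 1 0

/-- The `n`-th vertex of the succession line has `c` children. -/
def LineChildren (c : ℕ) : ℤ → RootedOFT 1 → Prop
  | Int.ofNat n => iterStep Forward (fun G => G.T.numChildren (G.root 0) = c) n
  | Int.negSucc n => iterStep Backward (fun G => G.T.numChildren (G.root 0) = c) (n + 1)

theorem isLocal_lineChildren (c : ℕ) (n : ℤ) : IsLocal (LineChildren c n) := by
  rcases n with n | n
  · exact isLocal_forward.iterStep (isLocal_numChildren 0 c) n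
  · exact isLocal_backward.iterStep (isLocal_numChildren 0 c) (n + 1)

theorem iterStep_iff {Q : RootedOFT 2 → Prop} {S : RootedOFT 1 → Prop} {k : ℕ} {G : RootedOFT k}
    {g : G.V → G.V} (h : ∀ u v, Q (G.withRoots u v) ↔ g u = v) (n : ℕ) (o : G.V) :
    iterStep Q S n (G.withRoot o) ↔ S (G.withRoot (g^[n] o)) := by
  induction n generalizing o with
  | zero => exact Iff.rfl
  | succ n ih =>
    rw [Function.iterate_succ_apply, ← ih]
    constructor
    · rintro ⟨v, hv, h'⟩
      obtain rfl := (h o v).1 hv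
      exact h'
    · exact fun h' => ⟨g o, (h o _).2 rfl, h'⟩

theorem lineChildren_iff {k : ℕ} {G : RootedOFT k} (hT : G.T.IsBiinfinite) (c : ℕ) (n : ℤ)
    (o : G.V) : LineChildren c n (G.withRoot o) ↔
      G.T.numChildren (G.T.successionLine o n) = c := by
  rcases n with n | n
  · exact iterStep_iff (fun u v => hT.eternal.isPred_iff_localPred.symm.trans hT.isPred_iff) n o
  · exact iterStep_iff (fun u v => hT.eternal.isPred_iff_localPred.symm.trans hT.isPred_iff')
      (n + 1) o

/-- A chain of genuine backward steps breaks off at a minimum, whereas `b` stays there by its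
default value. This makes the number of predecessors measurable. -/
theorem iterStep_backward_iff {k : ℕ} {G : RootedOFT k} (hE : G.T.IsEternal)
    (ha : ∀ u, G.T.IsPred u (G.T.a u)) (n : ℕ) (v : G.V) :
    iterStep Backward (fun _ => True) n (G.withRoot v) ↔ ∃ m, G.T.a^[n] m = v := by
  induction n generalizing v with
  | zero => exact ⟨fun _ => ⟨v, rfl⟩, fun _ => trivial⟩
  | succ n ih =>
    constructor
    · rintro ⟨u, hu, h⟩
      obtain ⟨m, rfl⟩ := (ih u).1 h
      refine ⟨m, ?_⟩
      rw [Function.iterate_succ_apply']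
      exact hE.a_eq (hE.isPred_iff_localPred.2 hu)
    · rintro ⟨m, rfl⟩
      rw [Function.iterate_succ_apply']
      exact ⟨G.T.a^[n] m, hE.isPred_iff_localPred.1 (ha _), (ih _).2 ⟨m, rfl⟩⟩

end RootedOFT

/-! ### Vertices with finitely many predecessors -/

namespace OrderedFamilyTree

variable {V : Type} {T : OrderedFamilyTree V}

/-- Going back `n` steps from either vertex leads to a vertex without predecessor, and there is only
one such vertex. -/
theorem HasUniqueSuccessionLine.eq_of_finite_past (h : T.HasUniqueSuccessionLine)
    (hE : T.IsEternal) {u v : V} {n : ℕ} (hu : ∃ m, T.a^[n] m = u)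
    (hu' : ¬ ∃ m, T.a^[n + 1] m = u) (hv : ∃ m, T.a^[n] m = v)
    (hv' : ¬ ∃ m, T.a^[n + 1] m = v) : u = v := by
  obtain ⟨m, rfl⟩ := hu
  obtain ⟨m', rfl⟩ := hv
  have key : ∀ m, (¬ ∃ x, T.a^[n + 1] x = T.a^[n] m) → ∀ u, ¬ T.IsPred u m := by
    rintro m hm u hu
    exact hm ⟨u, by rw [Function.iterate_succ_apply, hE.a_eq hu]⟩
  rw [h.minimum_unique hE (key m hu') (key m' hv')]

/-- An eternal tree with a unique succession line is bi-infinite if some vertex has arbitrarily many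
predecessors. -/
theorem HasUniqueSuccessionLine.isBiinfinite_of_past (h : T.HasUniqueSuccessionLine)
    (hE : T.IsEternal) (o : V)
    (ho : ∀ n, (∃ m, T.a^[n] m = o) → ∃ m, T.a^[n + 1] m = o) : T.IsBiinfinite := by
  refine h.isBiinfinite hE fun v => ?_
  by_contra hv
  push Not at hv
  have hb : T.b v = v := (hE.b_eq_self_or v).resolve_right (hv _)
  have hm : o ∈ Set.range (T.successionLine v) := by rw [h.range_eq]; trivial
  have hinj : Function.Injective T.a := fun x y hxy =>
    hE.isPred_unique_left (h.isPred_a hE x) (hxy ▸ h.isPred_a hE y)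
  have hex : ∃ n, T.a^[n] v = o := by
    obtain ⟨n, hn | hn⟩ := mem_range_successionLine.1 hm
    · exact ⟨n, hn⟩
    · rw [Function.iterate_fixed hb] at hn
      exact ⟨0, hn⟩
  obtain ⟨n, rfl⟩ := hex
  obtain ⟨m, hm⟩ := ho n ⟨v, rfl⟩
  rw [Function.iterate_succ_apply] at hm
  exact hv m ((hinj.iterate n hm) ▸ h.isPred_a hE m)

end OrderedFamilyTree

/-! ### A measurable version of the backward map -/

namespace TreeSpace

open RootedOFT

theorem mk_withRoot_origin (q : TreeSpace 1) : mk (q.rep.withRoot q.origin) = q := by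
  rw [origin, withRoot_root, mk_rep]

theorem second_doublyRooted (q : TreeSpace 1) (u v : q.rep.V) :
    second (q.doublyRooted u v) = mk (q.rep.withRoot v) := second_mk _

/-- The second alternative lets `Nat.find` be applied to every tree; where no count exists it
returns `0`, so that `offspring` takes the value `-1`. -/
theorem exists_lineChildren (n : ℤ) (q : TreeSpace 1) :
    ∃ c, LineChildren c n q.rep ∨ ¬ ∃ c, LineChildren c n q.rep := by
  by_cases h : ∃ c, LineChildren c n q.rep
  · obtain ⟨c, h⟩ := h
    exact ⟨c, Or.inl h⟩
  · exact ⟨0, Or.inr h⟩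

open Classical in
/-- A measurable version of the backward map. -/
noncomputable def offspring (q : TreeSpace 1) (n : ℤ) : ℤ :=
  (Nat.find (exists_lineChildren (n + 1) q) : ℤ) - 1

theorem measurable_offspring : Measurable offspring := by
  classical
  refine measurable_pi_iff.2 fun n => ?_
  have h : Measurable fun q : TreeSpace 1 => Nat.find (exists_lineChildren (n + 1) q) := by
    refine measurable_find _ fun c => ?_
    have hc : ∀ c, MeasurableSet {q : TreeSpace 1 | LineChildren c (n + 1) q.rep} := fun c =>
      measurableSet_of_isLocal (isLocal_lineChildren c (n + 1))
    have hn : {q : TreeSpace 1 | ¬ ∃ c, LineChildren c (n + 1) q.rep} =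
        (⋃ c, {q : TreeSpace 1 | LineChildren c (n + 1) q.rep})ᶜ := by
      ext q
      simp
    have hm : MeasurableSet {q : TreeSpace 1 | ¬ ∃ c, LineChildren c (n + 1) q.rep} := by
      rw [hn]
      exact (MeasurableSet.iUnion hc).compl
    exact (hc c).union hm
  exact (measurable_from_top (f := fun m : ℕ => (m : ℤ) - 1)).comp h

theorem offspring_mk {k : ℕ} {G : RootedOFT k} (hT : G.T.IsBiinfinite) (o : G.V) :
    offspring (mk (G.withRoot o)) =
      fun n => (G.T.numChildren (G.T.successionLine o (n + 1)) : ℤ) - 1 := by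
  classical
  funext n
  have hiff : ∀ c, LineChildren c (n + 1) (mk (G.withRoot o)).rep ↔
      G.T.numChildren (G.T.successionLine o (n + 1)) = c := fun c =>
    ((isLocal_lineChildren c (n + 1)).rep_mk _).trans (lineChildren_iff hT c (n + 1) o)
  have hs := Nat.find_spec (exists_lineChildren (n + 1) (mk (G.withRoot o)))
  rcases hs with hs | hs
  · rw [hiff] at hs
    rw [offspring, ← hs]
  · exact absurd ⟨_, (hiff _).2 rfl⟩ hs

theorem offspring_eq_backwardMap {q : TreeSpace 1} (hT : q.rep.T.IsBiinfinite) :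
    q.offspring = q.backwardMap := by
  conv_lhs => rw [← q.mk_withRoot_origin]
  exact offspring_mk hT _

theorem rootedComponent_backwardMap {q : TreeSpace 1} (hT : q.rep.T.IsBiinfinite) :
    RecordGraph.rootedComponent q.backwardMap = q := by
  conv_rhs => rw [← q.mk_withRoot_origin]
  exact (hT.mk_eq_rootedComponent q.origin).symm

theorem doublyRooted_mem_iff {S : RootedOFT 2 → Prop} (h : IsLocal S) (q : TreeSpace 1)
    (u v : q.rep.V) : S (q.doublyRooted u v).rep ↔ S (q.rep.withRoots u v) :=
  h.rep_mk _

end TreeSpace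

/-! ### Mass transport and stationarity -/

section Unimodular

open RootedOFT TreeSpace

variable {Ω : Type*} [MeasurableSpace Ω] {P : Measure Ω} {X : Ω → TreeSpace 1}

/-- In a unimodular eternal tree, a property that holds for at most one vertex does not hold for the
root. -/
theorem IsUnimodular.measure_eq_zero [IsProbabilityMeasure P] (hX : Measurable X)
    (hU : IsUnimodular X P) (hE : ∀ᵐ ω ∂P, (X ω).rep.T.IsEternal) {C : Set (TreeSpace 1)}
    (hC : MeasurableSet C)
    (huniq : ∀ᵐ ω ∂P, ∀ u v, mk ((X ω).rep.withRoot u) ∈ C → mk ((X ω).rep.withRoot v) ∈ C →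
      u = v) : P (X ⁻¹' C) = 0 := by
  classical
  have hD : MeasurableSet (second ⁻¹' C) := continuous_second.measurable hC
  -- Each vertex sends mass one to every vertex with the property. The root sends at most one in
  -- total, but receives infinite mass if it has the property itself.
  have h := hU ((second ⁻¹' C).indicator 1) (measurable_one.indicator hD)
  have hf : ∀ (q : TreeSpace 1) (u v : q.rep.V), (((second ⁻¹' C).indicator 1
      (q.doublyRooted u v) : ℝ≥0) : ℝ≥0∞) = if mk (q.rep.withRoot v) ∈ C then 1 else 0 := by
    intro q u v
    simp only [Set.indicator_apply, Set.mem_preimage, second_doublyRooted, Pi.one_apply]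
    split_ifs <;> simp
  simp only [hf, mk_withRoot_origin] at h
  have hl : ∫⁻ ω, ∑' u : (X ω).rep.V, (if mk ((X ω).rep.withRoot u) ∈ C then 1 else 0 : ℝ≥0∞) ∂P
      ≤ 1 := by
    calc _ ≤ ∫⁻ _, 1 ∂P := by
          refine lintegral_mono_ae ?_
          filter_upwards [huniq] with ω hω
          by_cases hex : ∃ u, mk ((X ω).rep.withRoot u) ∈ C
          · obtain ⟨u, hu⟩ := hex
            rw [tsum_eq_single u fun v hv => if_neg fun hv' => hv (hω v u hv' hu), if_pos hu]
          · push Not at hex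
            simp [hex]
      _ = 1 := by simp
  have hr : ⊤ * P (X ⁻¹' C) ≤
      ∫⁻ ω, ∑' _ : (X ω).rep.V, (if X ω ∈ C then 1 else 0 : ℝ≥0∞) ∂P := by
    rw [← lintegral_indicator_const (hX hC)]
    refine lintegral_mono_ae ?_
    filter_upwards [hE] with ω hω
    by_cases hω' : X ω ∈ C
    · have := hω.infinite (X ω).origin
      simp only [hω', if_true]
      rw [ENNReal.tsum_const_eq_top_of_ne_zero one_ne_zero]
      exact le_top
    · simp [hω']
  by_contra hne
  rw [ENNReal.top_mul hne, ← h] at hr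
  exact absurd (hr.trans hl) (by simp)

theorem IsUnimodular.ae_isBiinfinite [IsProbabilityMeasure P] (hX : Measurable X)
    (hU : IsUnimodular X P) (hE : ∀ᵐ ω ∂P, (X ω).rep.T.IsEternal)
    (hS : ∀ᵐ ω ∂P, (X ω).rep.T.HasUniqueSuccessionLine) :
    ∀ᵐ ω ∂P, (X ω).rep.T.IsBiinfinite := by
  have hloc : ∀ n, IsLocal (iterStep Backward (fun _ => True) n) := fun n =>
    isLocal_backward.iterStep (fun _ _ => ⟨0, fun _ _ => trivial⟩) n
  -- `C n`: the root has exactly `n` predecessors.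
  let C : ℕ → Set (TreeSpace 1) := fun n => {q | iterStep Backward (fun _ => True) n q.rep} \
    {q | iterStep Backward (fun _ => True) (n + 1) q.rep}
  have hC : ∀ n, MeasurableSet (C n) := fun n =>
    (measurableSet_of_isLocal (hloc n)).diff (measurableSet_of_isLocal (hloc (n + 1)))
  have hmem : ∀ q : TreeSpace 1, q.rep.T.HasUniqueSuccessionLine → q.rep.T.IsEternal →
      ∀ n (u : q.rep.V), mk (q.rep.withRoot u) ∈ C n ↔
        (∃ m, q.rep.T.a^[n] m = u) ∧ ¬ ∃ m, q.rep.T.a^[n + 1] m = u := by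
    intro q hq hqE n u
    rw [← iterStep_backward_iff hqE (hq.isPred_a hqE), ← iterStep_backward_iff hqE
      (hq.isPred_a hqE)]
    exact and_congr ((hloc n).rep_mk _) (not_congr ((hloc (n + 1)).rep_mk _))
  have hnull : ∀ᵐ ω ∂P, ∀ n, X ω ∉ C n := by
    rw [ae_all_iff]
    intro n
    have := hU.measure_eq_zero hX hE (hC n) (by
      filter_upwards [hE, hS] with ω h1 h2 u v hu hv
      rw [hmem _ h2 h1] at hu hv
      exact h2.eq_of_finite_past h1 hu.1 hu.2 hv.1 hv.2)
    exact measure_eq_zero_iff_ae_notMem.1 this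
  filter_upwards [hE, hS, hnull] with ω h1 h2 h3
  refine h2.isBiinfinite_of_past h1 (X ω).origin fun n hn => ?_
  by_contra hn'
  refine h3 n ?_
  rw [← (X ω).mk_withRoot_origin, hmem _ h2 h1]
  exact ⟨hn, hn'⟩

/-- The law of a unimodular tree with bi-infinite succession line is invariant under moving the root
to its successor. -/
theorem IsUnimodular.lintegral_successor (hX : Measurable X)
    (hU : IsUnimodular X P) (hB : ∀ᵐ ω ∂P, (X ω).rep.T.IsBiinfinite) {S : Set (TreeSpace 1)}
    (hS : MeasurableSet S) :
    ∫⁻ ω, S.indicator 1 (mk ((X ω).rep.withRoot ((X ω).rep.T.a (X ω).origin))) ∂P =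
      P (X ⁻¹' S) := by
  classical
  have hD : MeasurableSet ({q : TreeSpace 2 | Forward q.rep} ∩ second ⁻¹' S) :=
    (measurableSet_of_isLocal isLocal_forward).inter (continuous_second.measurable hS)
  -- Each vertex sends mass one to its successor `v` if `[T, v]` is in `S`. The root can receive
  -- mass only from `b` of the root.
  have h := hU (({q : TreeSpace 2 | Forward q.rep} ∩ second ⁻¹' S).indicator 1)
    (measurable_one.indicator hD)
  have hf : ∀ (q : TreeSpace 1) (_ : q.rep.T.IsBiinfinite) (u v : q.rep.V),
      ((({q : TreeSpace 2 | Forward q.rep} ∩ second ⁻¹' S).indicator 1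
      (q.doublyRooted u v) : ℝ≥0) : ℝ≥0∞) =
        if q.rep.T.a u = v then S.indicator 1 (mk (q.rep.withRoot v)) else 0 := by
    intro q hq u v
    have h1 : Forward (q.doublyRooted u v).rep ↔ q.rep.T.a u = v :=
      (doublyRooted_mem_iff isLocal_forward q u v).trans
        (hq.eternal.isPred_iff_localPred.symm.trans hq.isPred_iff)
    simp only [Set.indicator_apply, Set.mem_inter_iff, Set.mem_ofPred_eq, h1, Set.mem_preimage,
      second_doublyRooted, Pi.one_apply]
    split_ifs <;> simp_all
  calc _ = ∫⁻ ω, ∑' u : (X ω).rep.V, ((({q : TreeSpace 2 | Forward q.rep} ∩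
        second ⁻¹' S).indicator 1 ((X ω).doublyRooted (X ω).origin u) : ℝ≥0) : ℝ≥0∞) ∂P := by
        refine lintegral_congr_ae ?_
        filter_upwards [hB] with ω hω
        simp only [hf _ hω]
        rw [tsum_eq_single ((X ω).rep.T.a (X ω).origin) fun v hv => if_neg hv.symm, if_pos rfl]
    _ = _ := h
    _ = ∫⁻ ω, (X ⁻¹' S).indicator 1 ω ∂P := by
        refine lintegral_congr_ae ?_
        filter_upwards [hB] with ω hω
        simp only [hf _ hω]
        rw [tsum_eq_single ((X ω).rep.T.b (X ω).origin), if_pos (hω.a_b _), mk_withRoot_origin]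
        · rfl
        · exact fun v hv => if_neg fun h' => hv (by rw [← h', hω.b_a])
    _ = P (X ⁻¹' S) := lintegral_indicator_one (hX hS)

/-- A sequence whose law is invariant under the shift by one is stationary. -/
theorem isStationarySeq_of_shift {Y : Ω → ℤ → ℤ} (hY : Measurable Y)
    (h : P.map (fun ω n => Y ω (n + 1)) = P.map Y) : IsStationarySeq Y P := by
  have hs : ∀ k : ℤ, Measurable fun (y : ℤ → ℤ) n => y (n + k) := fun k =>
    measurable_pi_iff.2 fun n => measurable_pi_apply (n + k)
  have hnat : ∀ k : ℕ, (P.map Y).map (fun y n => y (n + k)) = P.map Y := by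
    intro k
    induction k with
    | zero => simp
    | succ k ih =>
      have : (fun (y : ℤ → ℤ) n => y (n + (k + 1 : ℕ))) =
          (fun y n => y (n + k)) ∘ fun y n => y (n + 1) := by
        funext y n
        simp only [Function.comp_apply, Nat.cast_succ]
        ring_nf
      rw [this, ← Measure.map_map (hs k) (hs 1), Measure.map_map (hs 1) hY]
      exact (congrArg _ h).trans ih
  have hint : ∀ k : ℤ, (P.map Y).map (fun y n => y (n + k)) = P.map Y := by
    intro k
    obtain ⟨k, rfl | rfl⟩ := k.eq_nat_or_neg
    · exact hnat k
    -- For a negative shift, replace the law by its image under the opposite shift, which then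
    -- cancels.
    · conv_lhs => rw [← hnat k]
      rw [Measure.map_map (hs _) (hs _)]
      convert Measure.map_id
      rename_i y
      funext n
      simp
  intro k
  refine ⟨((hs k).comp hY).aemeasurable, hY.aemeasurable, ?_⟩
  rw [← hint k, Measure.map_map (hs k) hY]
  rfl

theorem IsUnimodular.isStationarySeq_offspring (hX : Measurable X) (hU : IsUnimodular X P)
    (hB : ∀ᵐ ω ∂P, (X ω).rep.T.IsBiinfinite) :
    IsStationarySeq (fun ω => (X ω).offspring) P := by
  have hY : Measurable fun ω => (X ω).offspring := measurable_offspring.comp hX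
  have hs : Measurable fun ω n => (X ω).offspring (n + 1) :=
    measurable_pi_iff.2 fun n => (measurable_pi_apply (n + 1)).comp hY
  refine isStationarySeq_of_shift hY (Measure.ext fun A hA => ?_)
  rw [Measure.map_apply hs hA, Measure.map_apply hY hA]
  have h := hU.lintegral_successor hX hB (measurable_offspring hA)
  refine Eq.trans ?_ h
  rw [← lintegral_indicator_one (hs hA)]
  refine lintegral_congr_ae ?_
  filter_upwards [hB] with ω hω
  have h1 : offspring (mk ((X ω).rep.withRoot ((X ω).rep.T.a (X ω).origin))) =
      fun n => (X ω).offspring (n + 1) := by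
    rw [offspring_mk hω, offspring_eq_backwardMap hω]
    funext n
    rw [hω.successionLine_a]
    rfl
  change A.indicator (1 : (ℤ → ℤ) → ℝ≥0∞) (fun n => (X ω).offspring (n + 1)) =
    A.indicator 1 (offspring (mk ((X ω).rep.withRoot ((X ω).rep.T.a (X ω).origin))))
  rw [h1]

end Unimodular

theorem mainTheorem9 {Ω : Type*} [MeasurableSpace Ω] (P : Measure Ω) [IsProbabilityMeasure P]
    (X : Ω → TreeSpace 1) (hX : Measurable X) (hU : IsUnimodular X P)
    (hE : ∀ᵐ ω ∂P, (X ω).rep.T.IsEternal) :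
    (∀ᵐ ω ∂P, (X ω).rep.T.IsClassII → (X ω).rep.T.HasUniqueSuccessionLine) ∧
    (((∀ᵐ ω ∂P, (X ω).rep.T.HasUniqueSuccessionLine) ∨ (∀ᵐ ω ∂P, (X ω).rep.T.IsClassII)) →
      ∃ Y : Ω → ℤ → ℤ, Measurable Y ∧ (∀ ω n, -1 ≤ Y ω n) ∧ IsStationarySeq Y P ∧
        (∀ᵐ ω ∂P, Y ω = (X ω).backwardMap) ∧
        IdentDistrib X (fun ω => RecordGraph.rootedComponent (Y ω)) P P) := by
  have h1 : ∀ᵐ ω ∂P, (X ω).rep.T.IsClassII → (X ω).rep.T.HasUniqueSuccessionLine := by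
    filter_upwards [hE] with ω hω h
    exact hω.hasUniqueSuccessionLine h.2.1
  refine ⟨h1, fun h => ?_⟩
  have hS : ∀ᵐ ω ∂P, (X ω).rep.T.HasUniqueSuccessionLine := by
    rcases h with h | h
    · exact h
    · filter_upwards [h1, h] with ω h1 h
      exact h1 h
  have hB := hU.ae_isBiinfinite hX hE hS
  refine ⟨fun ω => (X ω).offspring, TreeSpace.measurable_offspring.comp hX, fun ω n => ?_,
    hU.isStationarySeq_offspring hX hB, ?_, IdentDistrib.of_ae_eq hX.aemeasurable ?_⟩
  · simp only [TreeSpace.offspring]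
    omega
  · filter_upwards [hB] with ω hω
    exact TreeSpace.offspring_eq_backwardMap hω
  -- The component tree equals `X` almost surely, which gives both its a.e. measurability and its
  -- law.
  · filter_upwards [hB] with ω hω
    rw [TreeSpace.offspring_eq_backwardMap hω, TreeSpace.rootedComponent_backwardMap hω]
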